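/- Let $n\ge 2$, let $\Omega\subset\mathbb R^n$ be a bounded domain of class $C^2$ with boundary $\Gamma$ and exterior unit normal $\nu$, let $T>0$, and set $Q=\Omega\times(0,T)$, $\Sigma=\Gamma\times(0,T)$, $\Omega_+=\Omega\times\{0\}$, $\Omega_-=\Omega\times\{T\}$. For a sign $\varepsilon=\pm$ (identified with $\pm1$), $\omega\in\mathbb S^{n-1}$ and $\rho\ge 0$ set \[ \Gamma_{\varepsilon,\omega}=\{x\in\Gamma:\ \varepsilon\,\nu(x)\cdot\omega>0\},\qquad \Sigma_{\varepsilon,\omega}=\Gamma_{\varepsilon,\omega}\times(0,T),\qquad \varphi_{\varepsilon,\omega,\rho}(x,t)=e^{-2\varepsilon(\rho\,\omega\cdot x+\rho^2t)} . \] Let $\Delta$ be the Laplacian in $x$ and let $\sigma$ be the surface measure on $\Gamma$. There is a constant $C>0$, depending only on $Q$, such that for every $m>0$ there is $\rho_0>0$, depending only on $Q$ and $m$, with the following property. For every sign $\varepsilon=\pm$, every $\omega\in\mathbb S^{n-1}$, every complex-valued $q\in L^\infty(Q)$ with $\|q\|_{L^\infty(Q)}\le m$, every $\rho\ge\rho_0$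 and every complex-valued $u\in C^2(\overline Q)$ with $u=0$ on $\Sigma\cup\Omega_\varepsilon$, \[ \begin{aligned} \int_{\Omega_{-\varepsilon}}\varphi_{\varepsilon,\omega,\rho}|u|^2\,dx &+\rho\int_{\Sigma_{\varepsilon,\omega}}\varphi_{\varepsilon,\omega,\rho}|\partial_\nu u|^2|\omega\cdot\nu|\,d\sigma\,dt +\rho^2\int_Q\varphi_{\varepsilon,\omega,\rho}|u|^2\,dx\,dt\\ &\le C\left(\int_Q\varphi_{\varepsilon,\omega,\rho}\,|(\varepsilon\partial_t-\Delta+q)u|^2\,dx\,dt +\rho\int_{\Sigma_{-\varepsilon,\omega}}\varphi_{\varepsilon,\omega,\rho}|\partial_\nu u|^2|\omega\cdot\nu|\,d\sigma\,dt\right). \end{aligned} \] -/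

import Mathlib

open MeasureTheory Set Topology
open scoped InnerProductSpace Laplacian

noncomputable section

namespace ParabolicCarleman

/-- A bounded domain (nonempty connected open set) of class `C²` in `ℝⁿ`: near each of its boundary
points it is, in suitable orthonormal coordinates, the region above the graph of a `C²` function.
Here `e` is the unit vector of the vertical axis, and `γ` is a function on the hyperplane orthogonal
to `e`. -/
structure IsBoundedC2Domain {n : ℕ} (Ω : Set (EuclideanSpace ℝ (Fin n))) : Prop where
  isOpen : IsOpen Ω
  isConnected : IsConnected Ω
  isBounded : Bornology.IsBounded Ω
  graph : ∀ x₀ ∈ frontier Ω, ∃ r > 0, ∃ e : EuclideanSpace ℝ (Fin n), ‖e‖ = 1 ∧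
    ∃ γ : (Submodule.span ℝ {e})ᗮ → ℝ, ContDiff ℝ 2 γ ∧
      ∀ x ∈ Metric.ball x₀ r,
        (x ∈ Ω ↔ γ ((Submodule.span ℝ {e})ᗮ.orthogonalProjectionOnto x) < ⟪e, x⟫_ℝ)

/-- `v` is the exterior unit normal of `Ω` at `x`: to first order at `x`, the set `Ω` is the
half-space of the points `y` with `⟪y - x, v⟫ < 0`. -/
def IsExteriorUnitNormal {n : ℕ} (Ω : Set (EuclideanSpace ℝ (Fin n)))
    (x v : EuclideanSpace ℝ (Fin n)) : Prop :=
  ‖v‖ = 1 ∧ ∀ δ > 0, ∀ᶠ y in 𝓝 x,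
    (⟪y - x, v⟫_ℝ < -(δ * ‖y - x‖) → y ∈ Ω) ∧ (δ * ‖y - x‖ < ⟪y - x, v⟫_ℝ → y ∉ Ω)

open Classical in
/-- The exterior unit normal vector field `ν` of `Ω` (zero where there is no such normal). -/
def exteriorNormal {n : ℕ} (Ω : Set (EuclideanSpace ℝ (Fin n))) (x : EuclideanSpace ℝ (Fin n)) :
    EuclideanSpace ℝ (Fin n) :=
  if h : ∃ v, IsExteriorUnitNormal Ω x v then h.choose else 0

/-- The exterior unit normal at a point is unique. -/
theorem IsExteriorUnitNormal.unique {n : ℕ} {Ω : Set (EuclideanSpace ℝ (Fin n))}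
    {x v w : EuclideanSpace ℝ (Fin n)} (hv : IsExteriorUnitNormal Ω x v)
    (hw : IsExteriorUnitNormal Ω x w) : v = w := by
  by_contra hne
  have hlt : ⟪w, v⟫_ℝ < 1 := by
    rcases (real_inner_le_norm w v).lt_or_eq with h | h
    · simpa [hv.1, hw.1] using h
    · rw [hv.1, hw.1, mul_one] at h
      exact absurd ((inner_eq_one_iff_of_norm_eq_one hw.1 hv.1).1 h) (Ne.symm hne)
  set d := w - v with hd
  have hdv : ⟪d, v⟫_ℝ = ⟪w, v⟫_ℝ - 1 := by
    rw [hd, inner_sub_left, real_inner_self_eq_norm_sq, hv.1]; norm_num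
  have hdw : ⟪d, w⟫_ℝ = 1 - ⟪w, v⟫_ℝ := by
    rw [hd, inner_sub_left, real_inner_self_eq_norm_sq, hw.1, real_inner_comm]; norm_num
  have hd0 : 0 < ‖d‖ := norm_pos_iff.2 (sub_ne_zero.2 (Ne.symm hne))
  set δ := (1 - ⟪w, v⟫_ℝ) / (2 * ‖d‖) with hδ
  have hδ0 : 0 < δ := div_pos (by linarith) (by positivity)
  have hδd : δ * ‖d‖ = (1 - ⟪w, v⟫_ℝ) / 2 := by rw [hδ]; field_simp
  have hlim : Filter.Tendsto (fun s : ℝ => x + s • d) (𝓝[>] 0) (𝓝 x) := by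
    have hc : ContinuousAt (fun s : ℝ => x + s • d) 0 := by fun_prop
    have h0 := hc.tendsto
    simp only [zero_smul, add_zero] at h0
    exact h0.mono_left nhdsWithin_le_nhds
  obtain ⟨s, ⟨⟨h1, -⟩, ⟨-, h2⟩⟩, hs⟩ :=
    ((hlim.eventually ((hv.2 δ hδ0).and (hw.2 δ hδ0))).and self_mem_nhdsWithin).exists
  have hs0 : (0 : ℝ) < s := hs
  simp only [add_sub_cancel_left, inner_smul_left, norm_smul, Real.norm_eq_abs, abs_of_pos hs0,
    hdv, hdw, RCLike.conj_to_real] at h1 h2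
  have e1 : δ * (s * ‖d‖) = s * ((1 - ⟪w, v⟫_ℝ) / 2) := by rw [← hδd]; ring
  rw [e1] at h1 h2
  have hp : 0 < s * (1 - ⟪w, v⟫_ℝ) := mul_pos hs0 (by linarith)
  exact h2 (by linarith) (h1 (by linarith))

theorem IsExteriorUnitNormal.exteriorNormal_eq {n : ℕ} {Ω : Set (EuclideanSpace ℝ (Fin n))}
    {x v : EuclideanSpace ℝ (Fin n)} (hv : IsExteriorUnitNormal Ω x v) :
    exteriorNormal Ω x = v := by
  have h : ∃ v, IsExteriorUnitNormal Ω x v := ⟨v, hv⟩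
  rw [exteriorNormal, dif_pos h]
  exact h.choose_spec.unique hv

/-- A bounded domain of class `C²` has an exterior unit normal at each boundary point, so
`exteriorNormal` takes no default value there. -/
theorem IsBoundedC2Domain.isExteriorUnitNormal {n : ℕ} {Ω : Set (EuclideanSpace ℝ (Fin n))}
    (hΩ : IsBoundedC2Domain Ω) {x : EuclideanSpace ℝ (Fin n)} (hx : x ∈ frontier Ω) :
    IsExteriorUnitNormal Ω x (exteriorNormal Ω x) := by
  suffices h : ∃ v, IsExteriorUnitNormal Ω x v by
    obtain ⟨v, hv⟩ := h
    rwa [hv.exteriorNormal_eq]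
  obtain ⟨r, hr, e, he, γ, hγ, hg⟩ := hΩ.graph x hx
  set P := (Submodule.span ℝ {e})ᗮ.orthogonalProjectionOnto with hP
  set f : EuclideanSpace ℝ (Fin n) → ℝ := fun y => γ (P y) - ⟪e, y⟫_ℝ with hf
  have hPe : P e = 0 := by
    rw [hP, Submodule.orthogonalProjectionOnto_eq_zero_iff]
    exact Submodule.le_orthogonal_orthogonal _ (Submodule.mem_span_singleton_self e)
  have hmem : ∀ y ∈ Metric.ball x r, (y ∈ Ω ↔ f y < 0) := fun y hy => by
    rw [hg y hy, hf]; exact sub_neg.symm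
  have hγd : HasFDerivAt γ (fderiv ℝ γ (P x)) (P x) :=
    (hγ.differentiable (by norm_num)).differentiableAt.hasFDerivAt
  have hfd : HasFDerivAt f ((fderiv ℝ γ (P x)).comp P - innerSL ℝ e) x :=
    (hγd.comp x P.hasFDerivAt).sub (innerSL ℝ e).hasFDerivAt
  set f' := (fderiv ℝ γ (P x)).comp P - innerSL ℝ e with hf'
  have hball : Metric.ball x r ∈ 𝓝 x := Metric.ball_mem_nhds x hr
  have hfx : f x = 0 := by
    apply le_antisymm
    · by_contra hpos
      have hev := (hfd.continuousAt.eventually (lt_mem_nhds (not_le.1 hpos))).and hball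
      obtain ⟨y, hy, hyΩ⟩ := mem_closure_iff_nhds.1 (frontier_subset_closure hx) _ hev
      exact absurd ((hmem y hy.2).1 hyΩ) (not_lt.2 (le_of_lt hy.1))
    · rw [hΩ.isOpen.frontier_eq] at hx
      exact not_lt.1 fun h => hx.2 ((hmem x (Metric.mem_ball_self hr)).2 h)
  have hf'e : f' e = -1 := by
    simp [hf', hPe, he]
  obtain ⟨g, hgf⟩ : ∃ g, ∀ y, ⟪g, y⟫_ℝ = f' y :=
    ⟨(InnerProductSpace.toDual ℝ _).symm f', fun y => by simp⟩
  have hg0 : 0 < ‖g‖ := by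
    rw [norm_pos_iff]
    rintro rfl
    have := hgf e
    rw [inner_zero_left, hf'e] at this
    norm_num at this
  refine ⟨‖g‖⁻¹ • g, by rw [norm_smul, norm_inv, norm_norm, inv_mul_cancel₀ hg0.ne'],
    fun δ hδ => ?_⟩
  filter_upwards [hfd.isLittleO.def (mul_pos hδ hg0), hball] with y hy hyb
  rw [hfx, sub_zero, ← hgf, Real.norm_eq_abs, abs_le] at hy
  have hin : ⟪y - x, ‖g‖⁻¹ • g⟫_ℝ * ‖g‖ = ⟪g, y - x⟫_ℝ := by
    rw [inner_smul_right, real_inner_comm]; field_simp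
  rw [hmem y hyb]
  constructor
  · intro h
    have := mul_lt_mul_of_pos_right h hg0
    nlinarith [hy.2]
  · intro h
    have := mul_lt_mul_of_pos_right h hg0
    nlinarith [hy.1]

/-- The parabolic cylinder `Q = Ω × (0,T)`. -/
def cylinder {n : ℕ} (Ω : Set (EuclideanSpace ℝ (Fin n))) (T : ℝ) :
    Set (EuclideanSpace ℝ (Fin n) × ℝ) :=
  Ω ×ˢ Ioo 0 T

/-- The time of the base `Ω_ε` of the cylinder: `Ω_+ = Ω × {0}` and `Ω_- = Ω × {T}`. -/
def baseTime (T ε : ℝ) : ℝ :=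
  if 0 < ε then 0 else T

/-- The part `Γ_{ε,ω}` of the boundary of `Ω` on which `ε ν · ω > 0`. -/
def boundaryPart {n : ℕ} (Ω : Set (EuclideanSpace ℝ (Fin n))) (ε : ℝ)
    (ω : EuclideanSpace ℝ (Fin n)) : Set (EuclideanSpace ℝ (Fin n)) :=
  {x ∈ frontier Ω | 0 < ε * ⟪exteriorNormal Ω x, ω⟫_ℝ}

/-- The weight `φ_{ε,ω,ρ}(x,t) = exp (-2 ε (ρ ω · x + ρ² t))`. -/
def weight {n : ℕ} (ε : ℝ) (ω : EuclideanSpace ℝ (Fin n)) (ρ : ℝ)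
    (p : EuclideanSpace ℝ (Fin n) × ℝ) : ℝ :=
  Real.exp (-(ε * 2 * (ρ * ⟪ω, p.1⟫_ℝ + ρ ^ 2 * p.2)))

/-- The function `(ε ∂_t - Δ + q) u`, where `Δ` acts in the space variable. -/
def parabolicOp {n : ℕ} (ε : ℝ) (q u : EuclideanSpace ℝ (Fin n) × ℝ → ℂ)
    (p : EuclideanSpace ℝ (Fin n) × ℝ) : ℂ :=
  (ε : ℂ) * deriv (fun s : ℝ => u (p.1, s)) p.2
    - Δ (fun y : EuclideanSpace ℝ (Fin n) => u (y, p.2)) p.1 + q p * u p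

/-- The normal derivative `∂_ν u` at a point `(x,t)` of the lateral boundary, taken from inside. -/
def normalDeriv {n : ℕ} (Ω : Set (EuclideanSpace ℝ (Fin n)))
    (u : EuclideanSpace ℝ (Fin n) × ℝ → ℂ) (x : EuclideanSpace ℝ (Fin n)) (t : ℝ) : ℂ :=
  fderivWithin ℝ (fun y : EuclideanSpace ℝ (Fin n) => u (y, t)) (closure Ω) x (exteriorNormal Ω x)

/-- `∫_{Σ_{s,ω}} φ_{ε,ω,ρ} |∂_ν u|² |ω · ν| dσ dt` for a sign `s`, where `Σ_{s,ω} = Γ_{s,ω} × (0,T)`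
and `σ` is the surface measure, that is, the `(n-1)`-dimensional Hausdorff measure (normalized to be
Lebesgue measure on hyperplanes). -/
def lateralIntegral {n : ℕ} (Ω : Set (EuclideanSpace ℝ (Fin n))) (T s ε : ℝ)
    (ω : EuclideanSpace ℝ (Fin n)) (ρ : ℝ) (u : EuclideanSpace ℝ (Fin n) × ℝ → ℂ) : ENNReal :=
  ∫⁻ t in Ioo 0 T, ∫⁻ x in boundaryPart Ω s ω,
    ENNReal.ofReal (weight ε ω ρ (x, t) * ‖normalDeriv Ω u x t‖ ^ 2 * |⟪ω, exteriorNormal Ω x⟫_ℝ|)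
      ∂(Measure.euclideanHausdorffMeasure (n - 1))

end ParabolicCarleman

end

/-!
Put `v = exp (-ε (ρ ω · x + ρ² t)) u`. Since `|ω| = 1`, the operator `ε ∂_t - Δ` becomes
`L = ε D - Δ` with the transport derivative `D = ∂_t - 2 ρ ω · ∇`: the terms of order zero cancel
(`ParabolicCarleman.conjugatedOp_halfWeight_mul`). The weighted integrals of `u` are integrals of
`v` without a weight, including the lateral ones, as `u = 0` on the lateral boundary, and the real
and the imaginary part can be treated separately
(`ParabolicCarleman.conjugated_estimate_complex`). The estimate for `v` rests on two facts.

* In `∫ |Lv|² ≥ ∫ |Dv|² - 2 ε ∫ Δv Dv`, the cross term is computed by integrating by parts. Its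
  `∂_t` part is an integral of `|∇v|²` over the base on which `v` need not vanish, with the good
  sign. Its `ω · ∇` part is, by the Rellich identity, the integral of `2 ε ρ |∂_ν v|² ν · ω` over
  the lateral boundary
  (`ParabolicCarleman.integral_transport_sq_add_lateral_le`).
* The function `g = ω · x + 2 ε R`, where `|x| ≤ R` on `Ω`, satisfies `D g = -2 ρ` and
  `R ≤ ε g ≤ 3 R`. Integrating `D (v² g)` bounds both `ρ² ∫ v²` and the integral of `v²` over the
  same base by a multiple of `∫ |Dv|²`
  (`ParabolicCarleman.integral_sq_le_integral_transport_sq`).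

Together they give `ParabolicCarleman.conjugated_estimate`, with a constant that depends on `R`
only. The term `q u` contributes at most a multiple of `m² ∫ φ |u|²` to the right-hand side, which
is absorbed by `ρ² ∫ φ |u|²` once `ρ` is large.

The integrations by parts need the divergence theorem on `Ω` for functions that are `C¹` up to the
boundary. Above the graph of a function it reduces to the fundamental theorem of calculus
(`ParabolicCarleman.integral_fderiv_graph`), with the surface element written in the coordinates of
the graph. That this surface element is the Hausdorff measure is the area formula, which is not
needed here: the parametrization of the graph is bi-Lipschitz, so the two measures are comparable,
and the estimate is only claimed up to a constant. A partition of unity yields a measure on the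
whole boundary for which the divergence theorem holds and which is comparable to the surface measure
(`ParabolicCarleman.IsBoundedC2Domain.exists_isBoundaryMeasure`).
-/

noncomputable section

namespace ParabolicCarleman

open Filter
open scoped NNReal ENNReal

/-! ### Boundary charts -/

section BoundaryCharts

section GraphCoordinates

variable {E : Type*} [NormedAddCommGroup E] [InnerProductSpace ℝ E]

/-- The defining function `γ(Px) - ⟪e, x⟫` of the region above the graph of `γ`, where `P` is the
orthogonal projection onto `e⊥`: the region is where it is negative. -/
def graphDefiningFun (e : E) (γ : (Submodule.span ℝ {e})ᗮ → ℝ) (x : E) : ℝ :=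
  γ ((Submodule.span ℝ {e})ᗮ.orthogonalProjectionOnto x) - ⟪e, x⟫_ℝ

/-- The parametrization `(y, s) ↦ y + (γ y + s) e`, which maps the half-spaces `s > 0` and `s < 0`
to the regions above and below the graph of `γ`. -/
def graphCoord (e : E) (γ : (Submodule.span ℝ {e})ᗮ → ℝ) (p : (Submodule.span ℝ {e})ᗮ × ℝ) : E :=
  p.1 + (γ p.1 + p.2) • e

variable {e : E} {γ : (Submodule.span ℝ {e})ᗮ → ℝ}

theorem proj_self : (Submodule.span ℝ {e})ᗮ.orthogonalProjectionOnto e = 0 := by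
  rw [Submodule.orthogonalProjectionOnto_eq_zero_iff]
  exact Submodule.le_orthogonal_orthogonal _ (Submodule.mem_span_singleton_self e)

theorem inner_self_orthogonal (y : (Submodule.span ℝ {e})ᗮ) : ⟪e, (y : E)⟫_ℝ = 0 :=
  Submodule.mem_orthogonal_singleton_iff_inner_right.1 y.2

theorem proj_graphCoord (p : (Submodule.span ℝ {e})ᗮ × ℝ) :
    (Submodule.span ℝ {e})ᗮ.orthogonalProjectionOnto (graphCoord e γ p) = p.1 := by
  simp [graphCoord, proj_self]

theorem inner_graphCoord (he : ‖e‖ = 1) (p : (Submodule.span ℝ {e})ᗮ × ℝ) :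
    ⟪e, graphCoord e γ p⟫_ℝ = γ p.1 + p.2 := by
  simp [graphCoord, inner_add_right, inner_smul_right, inner_self_orthogonal, he]

theorem graphDefiningFun_graphCoord (he : ‖e‖ = 1) (p : (Submodule.span ℝ {e})ᗮ × ℝ) :
    graphDefiningFun e γ (graphCoord e γ p) = -p.2 := by
  rw [graphDefiningFun, proj_graphCoord, inner_graphCoord he]; ring

theorem proj_add_inner_smul (he : ‖e‖ = 1) (x : E) :
    ((Submodule.span ℝ {e})ᗮ.orthogonalProjectionOnto x : E) + ⟪e, x⟫_ℝ • e = x := by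
  have h := Submodule.starProjection_add_starProjection_orthogonal (K := Submodule.span ℝ {e}) x
  rw [Submodule.starProjection_unit_singleton ℝ he] at h
  rw [add_comm]
  exact h

theorem graphCoord_proj (he : ‖e‖ = 1) (x : E) :
    graphCoord e γ ((Submodule.span ℝ {e})ᗮ.orthogonalProjectionOnto x, -graphDefiningFun e γ x)
      = x := by
  conv_rhs => rw [← proj_add_inner_smul he x]
  simp [graphCoord, graphDefiningFun]

theorem contDiff_graphDefiningFun (hγ : ContDiff ℝ 2 γ) :
    ContDiff ℝ 2 (graphDefiningFun e γ) := by
  unfold graphDefiningFun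
  exact (hγ.comp (ContinuousLinearMap.contDiff _)).sub (contDiff_const.inner ℝ contDiff_id)

theorem contDiff_graphCoord (hγ : ContDiff ℝ 2 γ) : ContDiff ℝ 2 (graphCoord e γ) := by
  unfold graphCoord
  exact ((Submodule.subtypeL _).contDiff.comp contDiff_fst).add
    (((hγ.comp contDiff_fst).add contDiff_snd).smul contDiff_const)

/-- `graphCoord` as a homeomorphism. -/
def graphHomeomorph (he : ‖e‖ = 1) (hγ : ContDiff ℝ 2 γ) : (Submodule.span ℝ {e})ᗮ × ℝ ≃ₜ E where
  toFun := graphCoord e γ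
  invFun x := ((Submodule.span ℝ {e})ᗮ.orthogonalProjectionOnto x, -graphDefiningFun e γ x)
  left_inv p := by
    dsimp only
    rw [proj_graphCoord, graphDefiningFun_graphCoord he, neg_neg]
  right_inv x := graphCoord_proj he x
  continuous_toFun := (contDiff_graphCoord hγ).continuous
  continuous_invFun :=
    (ContinuousLinearMap.continuous _).prodMk (contDiff_graphDefiningFun hγ).continuous.neg

theorem hasFDerivAt_graphDefiningFun (hγ : ContDiff ℝ 2 γ) (x : E) :
    HasFDerivAt (graphDefiningFun e γ)
      ((fderiv ℝ γ ((Submodule.span ℝ {e})ᗮ.orthogonalProjectionOnto x)).comp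
        (Submodule.span ℝ {e})ᗮ.orthogonalProjectionOnto - innerSL ℝ e) x :=
  (((hγ.differentiable (by norm_num)).differentiableAt.hasFDerivAt).comp x
    (ContinuousLinearMap.hasFDerivAt _)).sub (innerSL ℝ e).hasFDerivAt

theorem fderiv_graphDefiningFun_apply (hγ : ContDiff ℝ 2 γ) (x w : E) :
    fderiv ℝ (graphDefiningFun e γ) x w =
      fderiv ℝ γ ((Submodule.span ℝ {e})ᗮ.orthogonalProjectionOnto x)
        ((Submodule.span ℝ {e})ᗮ.orthogonalProjectionOnto w) - ⟪e, w⟫_ℝ := by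
  rw [(hasFDerivAt_graphDefiningFun hγ x).fderiv]; simp

theorem fderiv_graphDefiningFun_self (he : ‖e‖ = 1) (hγ : ContDiff ℝ 2 γ) (x : E) :
    fderiv ℝ (graphDefiningFun e γ) x e = -1 := by
  rw [fderiv_graphDefiningFun_apply hγ, proj_self]; simp [he]

variable [CompleteSpace E]

theorem one_le_norm_gradient (he : ‖e‖ = 1) (hγ : ContDiff ℝ 2 γ) (x : E) :
    1 ≤ ‖gradient (graphDefiningFun e γ) x‖ := by
  have h := abs_real_inner_le_norm (gradient (graphDefiningFun e γ) x) e
  rw [inner_gradient_left, fderiv_graphDefiningFun_self he hγ, he] at h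
  simpa using h

theorem continuous_gradient_graphDefiningFun (hγ : ContDiff ℝ 2 γ) :
    Continuous (gradient (graphDefiningFun e γ)) :=
  (InnerProductSpace.toDual ℝ E).symm.continuous.comp
    ((contDiff_graphDefiningFun hγ).continuous_fderiv (by norm_num))

end GraphCoordinates

variable {n : ℕ} {Ω : Set (EuclideanSpace ℝ (Fin n))}

/-- The ball `B(x₀, r)`, the axis `e` and the function `γ` present `Ω` near `x₀` as the region above
a `C²` graph. -/
structure IsGraphChart (Ω : Set (EuclideanSpace ℝ (Fin n))) (x₀ : EuclideanSpace ℝ (Fin n)) (r : ℝ)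
    (e : EuclideanSpace ℝ (Fin n)) (γ : (Submodule.span ℝ {e})ᗮ → ℝ) : Prop where
  r_pos : 0 < r
  norm_e : ‖e‖ = 1
  contDiff : ContDiff ℝ 2 γ
  mem_iff : ∀ x ∈ Metric.ball x₀ r, (x ∈ Ω ↔ graphDefiningFun e γ x < 0)

theorem IsBoundedC2Domain.exists_isGraphChart (hΩ : IsBoundedC2Domain Ω)
    {x₀ : EuclideanSpace ℝ (Fin n)} (hx : x₀ ∈ frontier Ω) :
    ∃ r e γ, IsGraphChart Ω x₀ r e γ := by
  obtain ⟨r, hr, e, he, γ, hγ, hg⟩ := hΩ.graph x₀ hx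
  exact ⟨r, e, γ, hr, he, hγ, fun x hx => (hg x hx).trans sub_neg.symm⟩

namespace IsGraphChart

variable {x₀ x e : EuclideanSpace ℝ (Fin n)} {r : ℝ} {γ : (Submodule.span ℝ {e})ᗮ → ℝ}

theorem mem_closure_iff (h : IsGraphChart Ω x₀ r e γ) (hx : x ∈ Metric.ball x₀ r) :
    x ∈ closure Ω ↔ graphDefiningFun e γ x ≤ 0 := by
  have hball : Metric.ball x₀ r ∈ 𝓝 x := Metric.isOpen_ball.mem_nhds hx
  have hcont := (contDiff_graphDefiningFun h.contDiff (e := e)).continuous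
  constructor
  · intro hc
    by_contra hpos
    have hev := (hcont.continuousAt.eventually (lt_mem_nhds (not_le.1 hpos))).and hball
    obtain ⟨y, hy, hyΩ⟩ := mem_closure_iff_nhds.1 hc _ hev
    exact absurd ((h.mem_iff y hy.2).1 hyΩ) (not_lt.2 (le_of_lt hy.1))
  · intro hle
    -- points slightly above `x` in the direction of the axis lie in `Ω`
    have hlim : Tendsto (fun s : ℝ => x + s • e) (𝓝[>] 0) (𝓝 x) := by
      have hc : ContinuousAt (fun s : ℝ => x + s • e) 0 := by fun_prop
      have h0 := hc.tendsto
      simp only [zero_smul, add_zero] at h0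
      exact h0.mono_left nhdsWithin_le_nhds
    refine mem_closure_of_tendsto hlim ?_
    filter_upwards [hlim.eventually hball, self_mem_nhdsWithin] with s hs hs0
    have hs0 : (0 : ℝ) < s := hs0
    rw [h.mem_iff _ hs]
    have : graphDefiningFun e γ (x + s • e) = graphDefiningFun e γ x - s := by
      simp [graphDefiningFun, proj_self, inner_add_right, inner_smul_right, h.norm_e]; ring
    rw [this]; linarith

theorem mem_frontier_iff (h : IsGraphChart Ω x₀ r e γ) (hΩ : IsOpen Ω)
    (hx : x ∈ Metric.ball x₀ r) : x ∈ frontier Ω ↔ graphDefiningFun e γ x = 0 := by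
  rw [hΩ.frontier_eq, Set.mem_sdiff, h.mem_closure_iff hx, h.mem_iff x hx, not_lt, le_antisymm_iff]

theorem exteriorNormal_eq (h : IsGraphChart Ω x₀ r e γ) (hΩ : IsOpen Ω)
    (hx : x ∈ Metric.ball x₀ r) (hxf : x ∈ frontier Ω) :
    exteriorNormal Ω x =
      ‖gradient (graphDefiningFun e γ) x‖⁻¹ • gradient (graphDefiningFun e γ) x := by
  apply IsExteriorUnitNormal.exteriorNormal_eq
  set g := gradient (graphDefiningFun e γ) x with hg
  have hg0 : 0 < ‖g‖ := one_pos.trans_le (one_le_norm_gradient h.norm_e h.contDiff x)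
  have hfd := ((contDiff_graphDefiningFun h.contDiff (e := e)).differentiable
    (by norm_num)).differentiableAt.hasFDerivAt (x := x)
  refine ⟨by rw [norm_smul, norm_inv, norm_norm, inv_mul_cancel₀ hg0.ne'], fun δ hδ => ?_⟩
  filter_upwards [hfd.isLittleO.def (mul_pos hδ hg0), Metric.isOpen_ball.mem_nhds hx] with y hy hyb
  rw [(h.mem_frontier_iff hΩ hx).1 hxf, sub_zero, ← inner_gradient_left, ← hg, Real.norm_eq_abs,
    abs_le] at hy
  have hin : ⟪y - x, ‖g‖⁻¹ • g⟫_ℝ * ‖g‖ = ⟪g, y - x⟫_ℝ := by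
    rw [inner_smul_right, real_inner_comm]; field_simp
  rw [h.mem_iff y hyb]
  constructor
  · intro h
    have := mul_lt_mul_of_pos_right h hg0
    nlinarith [hy.2]
  · intro h
    have := mul_lt_mul_of_pos_right h hg0
    nlinarith [hy.1]

theorem fderiv_graphDefiningFun_eq (h : IsGraphChart Ω x₀ r e γ) (hΩ : IsOpen Ω)
    (hx : x ∈ Metric.ball x₀ r) (hxf : x ∈ frontier Ω) (w : EuclideanSpace ℝ (Fin n)) :
    fderiv ℝ (graphDefiningFun e γ) x w =
      ‖gradient (graphDefiningFun e γ) x‖ * ⟪exteriorNormal Ω x, w⟫_ℝ := by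
  have hg0 := one_pos.trans_le (one_le_norm_gradient h.norm_e h.contDiff x)
  rw [h.exteriorNormal_eq hΩ hx hxf, ← inner_gradient_left, inner_smul_left]
  simp only [conj_trivial]
  field_simp

end IsGraphChart

theorem IsBoundedC2Domain.continuousOn_exteriorNormal (hΩ : IsBoundedC2Domain Ω) :
    ContinuousOn (exteriorNormal Ω) (frontier Ω) := by
  intro x hx
  obtain ⟨r, e, γ, h⟩ := hΩ.exists_isGraphChart hx
  have hg0 := one_pos.trans_le (one_le_norm_gradient h.norm_e h.contDiff x)
  have hc := continuous_gradient_graphDefiningFun h.contDiff (e := e)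
  have hxb := Metric.mem_ball_self h.r_pos (x := x)
  refine ContinuousWithinAt.congr_of_eventuallyEq
    ((hc.norm.continuousAt.inv₀ hg0.ne').smul hc.continuousAt).continuousWithinAt ?_
    (h.exteriorNormal_eq hΩ.isOpen hxb hx)
  filter_upwards [self_mem_nhdsWithin, mem_nhdsWithin_of_mem_nhds (Metric.isOpen_ball.mem_nhds hxb)]
    with y hy hyb
  exact h.exteriorNormal_eq hΩ.isOpen hyb hy

/-- The tangent cone of `Ω` at a boundary point contains the open half-space of the inward
directions. -/
theorem IsBoundedC2Domain.uniqueDiffOn_closure (hΩ : IsBoundedC2Domain Ω) :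
    UniqueDiffOn ℝ (closure Ω) := by
  intro x hx
  by_cases hxΩ : x ∈ Ω
  · exact uniqueDiffWithinAt_of_mem_nhds (mem_of_superset (hΩ.isOpen.mem_nhds hxΩ) subset_closure)
  have hxf : x ∈ frontier Ω := by rw [hΩ.isOpen.frontier_eq]; exact ⟨hx, hxΩ⟩
  obtain ⟨hν1, hν⟩ := hΩ.isExteriorUnitNormal hxf
  set ν := exteriorNormal Ω x
  have key : ∀ w, ⟪w, ν⟫_ℝ < 0 → w ∈ tangentConeAt ℝ (closure Ω) x := by
    intro w hw
    have hw0 : 0 < ‖w‖ := norm_pos_iff.2 (by rintro rfl; simp at hw)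
    set δ := -⟪w, ν⟫_ℝ / (2 * ‖w‖) with hδ
    have hδ0 : 0 < δ := div_pos (by linarith) (by positivity)
    have hδw : δ * ‖w‖ = -⟪w, ν⟫_ℝ / 2 := by rw [hδ]; field_simp
    have hlim : Tendsto (fun s : ℝ => x + s • w) (𝓝[>] 0) (𝓝 x) := by
      have hc : ContinuousAt (fun s : ℝ => x + s • w) 0 := by fun_prop
      have h0 := hc.tendsto
      simp only [zero_smul, add_zero] at h0
      exact h0.mono_left nhdsWithin_le_nhds
    refine mem_tangentConeAt_of_add_smul_mem (l := 𝓝[>] (0 : ℝ)) (c := id)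
      (tendsto_id'.2 (nhdsWithin_mono _ fun s hs => (ne_of_gt hs : s ≠ 0))) ?_
    filter_upwards [hlim.eventually (hν δ hδ0), self_mem_nhdsWithin] with s hs hs0
    have hs0 : (0 : ℝ) < s := hs0
    refine subset_closure (hs.1 ?_)
    simp only [add_sub_cancel_left, inner_smul_left, norm_smul, Real.norm_eq_abs, abs_of_pos hs0,
      RCLike.conj_to_real]
    have e1 : δ * (s * ‖w‖) = s * (-⟪w, ν⟫_ℝ / 2) := by rw [← hδw]; ring
    rw [e1]
    nlinarith [mul_pos hs0 (neg_pos.2 hw)]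
  refine ⟨?_, by rwa [closure_closure]⟩
  have htop : Submodule.span ℝ (tangentConeAt ℝ (closure Ω) x) = ⊤ := by
    rw [eq_top_iff]
    intro w _
    have hνν : ⟪ν, ν⟫_ℝ = 1 := by rw [real_inner_self_eq_norm_sq, hν1]; norm_num
    have h1 : -ν ∈ Submodule.span ℝ (tangentConeAt ℝ (closure Ω) x) :=
      Submodule.subset_span (key _ (by rw [inner_neg_left, hνν]; norm_num))
    have h2 : w - (⟪w, ν⟫_ℝ + 1) • ν ∈ Submodule.span ℝ (tangentConeAt ℝ (closure Ω) x) :=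
      Submodule.subset_span (key _ (by rw [inner_sub_left, inner_smul_left, hνν]; simp))
    have := Submodule.sub_mem _ h2 (Submodule.smul_mem _ (⟪w, ν⟫_ℝ + 1) h1)
    simpa using this
  rw [htop]
  simp

end BoundaryCharts

/-! ### The divergence theorem above a graph -/

section DivergenceTheorem

section HalfSpace

variable {H : Type*} [NormedAddCommGroup H] [NormedSpace ℝ H]

theorem fderivWithin_eq_zero_of_notMem_tsupport {G : Type*} [NormedAddCommGroup G]
    [NormedSpace ℝ G] {k : H → G} {S : Set H} {p : H} (hp : p ∉ tsupport k) :
    fderivWithin ℝ k S p = 0 := by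
  have h0 := notMem_tsupport_iff_eventuallyEq.1 hp
  have := (h0.filter_mono nhdsWithin_le_nhds).fderivWithin_eq (𝕜 := ℝ) (s := S) h0.self_of_nhds
  rw [this]
  simp

variable [FiniteDimensional ℝ H] [MeasurableSpace H] [BorelSpace H]
  (μ : Measure H) [μ.IsAddHaarMeasure]

theorem integral_fderiv_eq_zero_of_hasCompactSupport {k : H → ℝ} (hk : ContDiff ℝ 1 k)
    (hc : HasCompactSupport k) (w : H) : ∫ x, fderiv ℝ k x w ∂μ = 0 := by
  have hi : Integrable (fun x => fderiv ℝ k x w) μ :=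
    Continuous.integrable_of_hasCompactSupport
      ((hk.continuous_fderiv (by norm_num)).clm_apply continuous_const) (hc.fderiv_apply ℝ w)
  have := integral_mul_fderiv_eq_neg_fderiv_mul_of_integrable (f := fun _ : H => (1 : ℝ)) (g := k)
    (v := w) (μ := μ) (by simp) (by simpa using hi)
    (by simpa using hk.continuous.integrable_of_hasCompactSupport hc)
    (fun x _ => by fun_prop) (fun x _ => (hk.differentiable (by norm_num)) x)
  simpa using this

omit [FiniteDimensional ℝ H] [BorelSpace H] [MeasurableSpace H] in
theorem uniqueDiffOn_halfSpace : UniqueDiffOn ℝ ((univ : Set H) ×ˢ Ici (0 : ℝ)) :=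
  uniqueDiffOn_univ.prod (uniqueDiffOn_Ici 0)

omit [NormedSpace ℝ H] [FiniteDimensional ℝ H] [BorelSpace H] [MeasurableSpace H] in
theorem halfSpace_mem_nhds {p : H × ℝ} (hp : 0 < p.2) :
    (univ : Set H) ×ˢ Ici (0 : ℝ) ∈ 𝓝 p :=
  prod_mem_nhds univ_mem (Ici_mem_nhds hp)

omit [FiniteDimensional ℝ H] in
theorem integrableOn_fderiv_halfSpace {k : H × ℝ → ℝ}
    (hk : ContDiffOn ℝ 1 k (univ ×ˢ Ici 0)) (hc : HasCompactSupport k) (w : H × ℝ) :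
    IntegrableOn (fun p => fderiv ℝ k p w) (univ ×ˢ Ioi 0) (μ.prod volume) := by
  set S := (univ : Set H) ×ˢ Ici (0 : ℝ)
  have hS : IsClosed S := isClosed_univ.prod isClosed_Ici
  have hcont : ContinuousOn (fun p => fderivWithin ℝ k S p w) S :=
    (hk.continuousOn_fderivWithin uniqueDiffOn_halfSpace le_rfl).clm_apply continuousOn_const
  have h1 : IntegrableOn (fun p => fderivWithin ℝ k S p w) (S ∩ tsupport k) (μ.prod volume) :=
    (hcont.mono inter_subset_left).integrableOn_compact (hc.isCompact.inter_left hS)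
  have h2 : IntegrableOn (fun p => fderivWithin ℝ k S p w) S (μ.prod volume) := by
    refine h1.of_forall_sdiff_eq_zero hS.measurableSet fun p hp => ?_
    rw [fderivWithin_eq_zero_of_notMem_tsupport fun h => hp.2 ⟨hp.1, h⟩]; rfl
  refine (h2.mono_set (prod_mono_right Ioi_subset_Ici_self)).congr_fun (fun p hp => ?_)
    (MeasurableSet.univ.prod measurableSet_Ioi)
  dsimp only
  rw [fderivWithin_of_mem_nhds (halfSpace_mem_nhds hp.2)]

/-- The divergence theorem in a half-space, for a field whose component across the boundary is
multiplied by a function `a` of the tangential variable. -/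
theorem integral_fderiv_halfSpace {k : H × ℝ → ℝ}
    (hk : ContDiffOn ℝ 1 k (univ ×ˢ Ici 0)) (hc : HasCompactSupport k) (w : H) {a : H → ℝ}
    (ha : Continuous a) :
    ∫ p in univ ×ˢ Ioi 0, (fderiv ℝ k p (w, 0) + a p.1 * fderiv ℝ k p (0, 1)) ∂(μ.prod volume) =
      -∫ y, a y * k (y, 0) ∂μ := by
  have hi1 := integrableOn_fderiv_halfSpace μ hk hc (w, 0)
  have hi2' := integrableOn_fderiv_halfSpace μ hk hc (0, 1)
  have hdiff : ∀ p : H × ℝ, 0 < p.2 → DifferentiableAt ℝ k p := fun p hp =>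
    (hk.contDiffAt (halfSpace_mem_nhds hp)).differentiableAt (by norm_num)
  have hi2 : IntegrableOn (fun p => a p.1 * fderiv ℝ k p (0, 1)) (univ ×ˢ Ioi 0)
      (μ.prod volume) := by
    have hm : MeasurableSet ((univ : Set H) ×ˢ Ioi (0 : ℝ)) :=
      MeasurableSet.univ.prod measurableSet_Ioi
    have := (hi2'.mono_set (inter_subset_left (t := tsupport k))).continuousOn_mul_of_subset
      (g := fun p : H × ℝ => a p.1) (K := tsupport k) (ha.comp continuous_fst).continuousOn
      hc.isCompact (hm.inter (isClosed_tsupport k).measurableSet) inter_subset_right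
    refine this.of_forall_sdiff_eq_zero hm fun p hp => ?_
    rw [← fderivWithin_univ, fderivWithin_eq_zero_of_notMem_tsupport fun h => hp.2 ⟨hp.1, h⟩]
    simp
  rw [integral_add hi1 hi2, ← Measure.prod_restrict, Measure.restrict_univ]
  have hz : ∫ p, fderiv ℝ k p (w, 0) ∂(μ.prod (volume.restrict (Ioi 0))) = 0 := by
    rw [integral_prod_symm _ (by simpa [IntegrableOn, ← Measure.prod_restrict] using hi1)]
    refine (setIntegral_congr_fun measurableSet_Ioi fun s hs => ?_).trans (integral_zero _ _)
    have hs : (0 : ℝ) < s := hs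
    have hks : ContDiff ℝ 1 fun y => k (y, s) := by
      rw [contDiff_iff_contDiffAt]
      intro y
      exact (hk.contDiffAt (halfSpace_mem_nhds (p := (y, s)) hs)).comp y
        (contDiff_id.prodMk contDiff_const).contDiffAt
    have hcs : HasCompactSupport fun y => k (y, s) := by
      refine HasCompactSupport.intro (hc.isCompact.image continuous_fst) fun y hy => ?_
      by_contra h
      exact hy ⟨(y, s), subset_tsupport _ h, rfl⟩
    refine Eq.trans ?_ (integral_fderiv_eq_zero_of_hasCompactSupport μ hks hcs w)
    refine integral_congr_ae (Eventually.of_forall fun y => ?_)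
    have h1 : HasFDerivAt (fun y : H => (y, s)) (ContinuousLinearMap.inl ℝ H ℝ) y :=
      hasFDerivAt_prodMk_left y s
    have h2 := ((hdiff (y, s) hs).hasFDerivAt.comp y h1).fderiv
    simp only [Function.comp_def] at h2
    simp [h2]
  have hn : ∫ p, a p.1 * fderiv ℝ k p (0, 1) ∂(μ.prod (volume.restrict (Ioi 0))) =
      -∫ y, a y * k (y, 0) ∂μ := by
    have hi2'' : Integrable (fun p => fderiv ℝ k p (0, 1)) (μ.prod (volume.restrict (Ioi 0))) := by
      simpa [IntegrableOn, ← Measure.prod_restrict] using hi2'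
    rw [integral_prod _ (by simpa [IntegrableOn, ← Measure.prod_restrict] using hi2),
      ← integral_neg]
    refine integral_congr_ae ?_
    filter_upwards [hi2''.prod_right_ae] with y hy
    rw [integral_const_mul]
    have hlim : Tendsto (fun s : ℝ => k (y, s)) atTop (𝓝 0) := by
      obtain ⟨R, hR⟩ := hc.isCompact.isBounded.subset_closedBall (0 : H × ℝ)
      refine tendsto_const_nhds.congr' ?_
      filter_upwards [eventually_gt_atTop R] with s hs
      by_contra h
      have := hR (subset_tsupport k (Ne.symm h))
      rw [mem_closedBall_zero_iff] at this
      have := (norm_snd_le (y, s)).trans this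
      exact absurd (le_trans (le_abs_self s) this) (not_le.2 hs)
    have hc0 : ContinuousWithinAt (fun s : ℝ => k (y, s)) (Ici 0) 0 := by
      have h1 := hk.continuousOn (y, 0) ⟨mem_univ _, self_mem_Ici⟩
      exact ContinuousWithinAt.comp (f := fun s : ℝ => (y, s)) (x := (0 : ℝ)) h1
        (by fun_prop) fun s hs => ⟨mem_univ _, hs⟩
    rw [integral_Ioi_of_hasDerivAt_of_tendsto hc0 (fun s hs => ?_) hy hlim]
    · ring
    have h1 : HasFDerivAt (fun s : ℝ => (y, s)) (ContinuousLinearMap.inr ℝ H ℝ) s :=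
      hasFDerivAt_prodMk_right y s
    have h2 := ((hdiff (y, s) hs).hasFDerivAt.comp s h1).hasDerivAt
    simpa [Function.comp_def] using h2
  rw [hz, hn, zero_add]

end HalfSpace

section GraphMeasure

variable {E : Type*} [NormedAddCommGroup E] [InnerProductSpace ℝ E] [FiniteDimensional ℝ E]
  [MeasurableSpace E] [BorelSpace E]
  {e : E} {γ : (Submodule.span ℝ {e})ᗮ → ℝ}

theorem measurePreserving_add_smul (he : ‖e‖ = 1) :
    MeasurePreserving (fun p : (Submodule.span ℝ {e})ᗮ × ℝ => (p.1 : E) + p.2 • e)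
      (volume.prod volume) volume := by
  have h1 := (Submodule.measurePreserving_measurableEquivProd (Submodule.span ℝ {e}) (0 : E)).symm
  rw [InnerProductSpace.euclideanHausdorffMeasure_eq_volume] at h1
  have h2 := (LinearIsometryEquiv.toSpanUnitSingleton (𝕜 := ℝ) e he).measurePreserving
  have h3 := (h2.prod (MeasurePreserving.id (volume : Measure (Submodule.span ℝ {e})ᗮ))).comp
    (Measure.measurePreserving_swap (μ := (volume : Measure (Submodule.span ℝ {e})ᗮ))
      (ν := (volume : Measure ℝ)))
  have h4 : (fun p : (Submodule.span ℝ {e})ᗮ × ℝ => (p.1 : E) + p.2 • e) =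
      (Submodule.measurableEquivProd (Submodule.span ℝ {e}) (0 : E)).symm ∘
        Prod.map (LinearIsometryEquiv.toSpanUnitSingleton (𝕜 := ℝ) e he) id ∘ Prod.swap := by
    funext p
    simp [add_comm]
  rw [h4]
  exact h1.comp h3

theorem measurePreserving_graphCoord (he : ‖e‖ = 1) (hγ : ContDiff ℝ 2 γ) :
    MeasurePreserving (graphCoord e γ) (volume.prod volume) volume := by
  refine (measurePreserving_add_smul he).comp (g := fun p : (Submodule.span ℝ {e})ᗮ × ℝ =>
    (p.1 : E) + p.2 • e) (f := fun p : (Submodule.span ℝ {e})ᗮ × ℝ => (p.1, γ p.1 + p.2)) ?_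
  have hm : Measurable (Function.uncurry fun (y : (Submodule.span ℝ {e})ᗮ) (s : ℝ) => γ y + s) :=
    ((hγ.continuous.comp continuous_fst).add continuous_snd).measurable
  exact (MeasurePreserving.id volume).skew_product hm
    (Eventually.of_forall fun y => (measurePreserving_add_left volume (γ y)).map_eq)

/-- The divergence theorem in the region above the graph of `γ`, in which it takes the form of the
half-space by the volume-preserving change of variables `graphCoord`. With `f` the defining
function, `∇f / ‖∇f‖` is the exterior unit normal and `‖∇f‖ dy` is the surface element. -/
theorem integral_fderiv_graph (he : ‖e‖ = 1) (hγ : ContDiff ℝ 2 γ) {h : E → ℝ}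
    (hh : ContDiffOn ℝ 1 h {x | graphDefiningFun e γ x ≤ 0}) (hc : HasCompactSupport h) (w : E) :
    ∫ x in {x | graphDefiningFun e γ x < 0}, fderiv ℝ h x w =
      ∫ y, h (graphCoord e γ (y, 0)) *
        fderiv ℝ (graphDefiningFun e γ) (graphCoord e γ (y, 0)) w := by
  set P := (Submodule.span ℝ {e})ᗮ.orthogonalProjectionOnto
  have hΨ := contDiff_graphCoord (e := e) hγ
  set k : (Submodule.span ℝ {e})ᗮ × ℝ → ℝ := h ∘ graphCoord e γ with hkdef
  have hk : ContDiffOn ℝ 1 k (univ ×ˢ Ici 0) :=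
    hh.comp (hΨ.of_le (by norm_num)).contDiffOn fun p hp => by
      have : (0 : ℝ) ≤ p.2 := hp.2
      simpa [graphDefiningFun_graphCoord he] using this
  have hkc : HasCompactSupport k := hc.comp_homeomorph (graphHomeomorph he hγ)
  set a : (Submodule.span ℝ {e})ᗮ → ℝ := fun y => ⟪e, w⟫_ℝ - fderiv ℝ γ y (P w) with hadef
  have ha : Continuous a := continuous_const.sub
    ((hγ.continuous_fderiv (by norm_num)).clm_apply continuous_const)
  have haf : ∀ p : (Submodule.span ℝ {e})ᗮ × ℝ,
      fderiv ℝ (graphDefiningFun e γ) (graphCoord e γ p) w = -a p.1 := fun p => by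
    rw [fderiv_graphDefiningFun_apply hγ, proj_graphCoord]; simp [hadef, P]
  have key := integral_fderiv_halfSpace volume hk hkc (P w) ha
  have hpre : graphCoord e γ ⁻¹' {x | graphDefiningFun e γ x < 0} = univ ×ˢ Ioi 0 := by
    ext p
    simp [graphDefiningFun_graphCoord he]
  rw [← (measurePreserving_graphCoord he hγ).setIntegral_preimage_emb
    (graphHomeomorph he hγ).measurableEmbedding, hpre]
  simp only [haf, mul_neg, integral_neg]
  have hR : ∫ y, h (graphCoord e γ (y, 0)) * a y = ∫ y, a y * k (y, 0) := by
    simp [hkdef, mul_comm]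
  rw [hR, ← key]
  refine setIntegral_congr_fun (MeasurableSet.univ.prod measurableSet_Ioi) fun p hp => ?_
  have hp : (0 : ℝ) < p.2 := hp.2
  have hd : HasFDerivAt h (fderiv ℝ h (graphCoord e γ p)) (graphCoord e γ p) := by
    refine DifferentiableAt.hasFDerivAt
      ((hh.contDiffAt ?_).differentiableAt (by norm_num))
    have : graphDefiningFun e γ (graphCoord e γ p) < 0 := by
      rw [graphDefiningFun_graphCoord he]; linarith
    filter_upwards [(contDiff_graphDefiningFun hγ (e := e)).continuous.continuousAt.eventually
      (gt_mem_nhds this)] with x hx using le_of_lt hx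
  have hγd : HasFDerivAt γ (fderiv ℝ γ p.1) p.1 :=
    (hγ.differentiable (by norm_num)).differentiableAt.hasFDerivAt
  have hΨd : HasFDerivAt (graphCoord e γ)
      ((Submodule.subtypeL _).comp (ContinuousLinearMap.fst ℝ _ ℝ) +
        ((fderiv ℝ γ p.1).comp (ContinuousLinearMap.fst ℝ _ ℝ) +
          ContinuousLinearMap.snd ℝ _ ℝ).smulRight e) p := by
    unfold graphCoord
    exact ((Submodule.subtypeL _).hasFDerivAt.comp p hasFDerivAt_fst).add
      (((hγd.comp p hasFDerivAt_fst).add hasFDerivAt_snd).smul_const e)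
  have hkd := (hd.comp p hΨd).fderiv
  simp only [hkdef, hkd]
  conv_lhs => rw [← proj_add_inner_smul he w]
  simp [hadef, P]
  ring

end GraphMeasure

end DivergenceTheorem

/-! ### A boundary measure comparable to the surface measure -/

section BoundaryMeasure

theorem _root_.LipschitzOnWith.euclideanHausdorffMeasure_image_le {X Y : Type*} [EMetricSpace X]
    [MeasurableSpace X] [BorelSpace X] [EMetricSpace Y] [MeasurableSpace Y] [BorelSpace Y]
    {K : ℝ≥0} {f : X → Y} {s : Set X} (h : LipschitzOnWith K f s) (d : ℕ) :
    Measure.euclideanHausdorffMeasure d (f '' s) ≤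
      (K : ℝ≥0∞) ^ d * Measure.euclideanHausdorffMeasure d s := by
  simp only [Measure.euclideanHausdorffMeasure_def, Measure.smul_apply, ENNReal.smul_def,
    smul_eq_mul]
  have := h.hausdorffMeasure_image_le (d := (d : ℝ)) (Nat.cast_nonneg d)
  rw [ENNReal.rpow_natCast] at this
  rw [mul_left_comm]
  gcongr

theorem contDiff_graphCoord_zero {E : Type*} [NormedAddCommGroup E] [InnerProductSpace ℝ E] {e : E}
    {γ : (Submodule.span ℝ {e})ᗮ → ℝ} (hγ : ContDiff ℝ 2 γ) :
    ContDiff ℝ 2 fun y => graphCoord e γ (y, 0) :=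
  (contDiff_graphCoord hγ).comp (contDiff_id.prodMk contDiff_const)

theorem exists_lipschitzOnWith_graphCoord {E : Type*} [NormedAddCommGroup E]
    [InnerProductSpace ℝ E] {e : E} {γ : (Submodule.span ℝ {e})ᗮ → ℝ} (hγ : ContDiff ℝ 2 γ)
    {S : Set (Submodule.span ℝ {e})ᗮ} (hS : IsCompact S) :
    ∃ K, LipschitzOnWith K (fun y => graphCoord e γ (y, 0)) S :=
  LocallyLipschitzOn.exists_lipschitzOnWith_of_compact hS
    ((contDiff_graphCoord_zero hγ).of_le (by norm_num)).locallyLipschitz.locallyLipschitzOn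

variable {n : ℕ} {Ω : Set (EuclideanSpace ℝ (Fin n))}

/-- The surface measure on the boundary of `Ω`: the `(n-1)`-dimensional Hausdorff measure on it. -/
def surfaceMeasure (Ω : Set (EuclideanSpace ℝ (Fin n))) : Measure (EuclideanSpace ℝ (Fin n)) :=
  (Measure.euclideanHausdorffMeasure (n - 1)).restrict (frontier Ω)

theorem finrank_orthogonal_span_unit {e : EuclideanSpace ℝ (Fin n)} (he : ‖e‖ = 1) :
    Module.finrank ℝ (Submodule.span ℝ {e})ᗮ = n - 1 := by
  have h1 := (Submodule.span ℝ {e}).finrank_add_finrank_orthogonal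
  have he0 : e ≠ 0 := by rintro rfl; simp at he
  rw [finrank_span_singleton he0, finrank_euclideanSpace_fin] at h1
  omega

namespace IsGraphChart

variable {x₀ e : EuclideanSpace ℝ (Fin n)} {r : ℝ} {γ : (Submodule.span ℝ {e})ᗮ → ℝ}

set_option maxHeartbeats 400000 in
/-- The parametrization of the boundary near `x₀` is bi-Lipschitz, so the measure `‖∇f‖ dy` carried
over to the boundary, where `f` is the defining function, is comparable to the surface measure. For
that measure the divergence theorem holds. -/
theorem exists_measure (h : IsGraphChart Ω x₀ r e γ) (hΩ : IsOpen Ω) :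
    ∃ (σ : Measure (EuclideanSpace ℝ (Fin n))) (C : ℝ≥0), IsFiniteMeasure σ ∧
      σ ≤ C • surfaceMeasure Ω ∧ (surfaceMeasure Ω).restrict (Metric.ball x₀ r) ≤ C • σ ∧
      ∀ g : EuclideanSpace ℝ (Fin n) → ℝ, ContDiffOn ℝ 1 g (closure Ω) →
        (∀ x ∉ Metric.closedBall x₀ (r / 2), g x = 0) → ∀ w,
        ∫ x in Ω, fderiv ℝ g x w = ∫ x, g x * ⟪exteriorNormal Ω x, w⟫_ℝ ∂σ := by
  have he := h.norm_e
  have hγ := h.contDiff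
  set P := (Submodule.span ℝ {e})ᗮ.orthogonalProjectionOnto with hP
  set Φ : (Submodule.span ℝ {e})ᗮ → EuclideanSpace ℝ (Fin n) := fun y => graphCoord e γ (y, 0)
    with hΦ
  have hPΦ : ∀ y, P (Φ y) = y := fun y => proj_graphCoord _
  have hΦc : Continuous Φ := (contDiff_graphCoord_zero hγ).continuous
  have hΦemb : MeasurableEmbedding Φ := by
    refine hΦc.measurableEmbedding fun y z hyz => ?_
    rw [← hPΦ y, ← hPΦ z, hyz]
  have hfΦ : ∀ y, graphDefiningFun e γ (Φ y) = 0 := fun y => by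
    rw [hΦ, graphDefiningFun_graphCoord he]; simp
  have hΦP : ∀ x, graphDefiningFun e γ x = 0 → Φ (P x) = x := fun x hx => by
    have := graphCoord_proj he x (γ := γ)
    rwa [hx, neg_zero] at this
  set B := Φ ⁻¹' Metric.ball x₀ r with hB
  have hBm : MeasurableSet B := hΦc.measurable Metric.isOpen_ball.measurableSet
  have hΦfr : ∀ y ∈ B, Φ y ∈ frontier Ω := fun y hy => (h.mem_frontier_iff hΩ hy).2 (hfΦ y)
  have hPlip : LipschitzWith 1 P := by
    refine P.lipschitz.weaken ?_
    exact_mod_cast Submodule.orthogonalProjectionOnto_norm_le _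
  set Kc := Metric.closedBall (P x₀) r with hKc
  have hKcc : IsCompact Kc := isCompact_closedBall _ _
  have hBK : B ⊆ Kc := fun y hy => by
    have := hPlip.dist_le_mul (Φ y) x₀
    rw [hPΦ, NNReal.coe_one, one_mul] at this
    have hy' : dist (Φ y) x₀ < r := hy
    exact Metric.mem_closedBall.2 (this.trans hy'.le)
  obtain ⟨K, hK⟩ := exists_lipschitzOnWith_graphCoord hγ hKcc
  set N : (Submodule.span ℝ {e})ᗮ → ℝ := fun y => ‖gradient (graphDefiningFun e γ) (Φ y)‖ with hN
  have hNc : Continuous N := ((continuous_gradient_graphDefiningFun hγ).comp hΦc).norm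
  obtain ⟨M, hM⟩ : ∃ M : ℝ≥0, ∀ y ∈ Kc, N y ≤ M := by
    obtain ⟨M, hM⟩ := hKcc.bddAbove_image hNc.continuousOn
    exact ⟨M.toNNReal, fun y hy => (hM ⟨y, hy, rfl⟩).trans (Real.le_coe_toNNReal M)⟩
  have hN1 : ∀ y, 1 ≤ N y := fun y => one_le_norm_gradient he hγ _
  have hvol : ∀ A : Set (Submodule.span ℝ {e})ᗮ,
      volume A = Measure.euclideanHausdorffMeasure (n - 1) A := fun A => by
    rw [← finrank_orthogonal_span_unit he, InnerProductSpace.euclideanHausdorffMeasure_eq_volume]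
  -- `Φ` is Lipschitz on compact sets, and its left inverse `P` is a contraction
  have hvol_le : ∀ A, volume A ≤ Measure.euclideanHausdorffMeasure (n - 1) (Φ '' A) := fun A => by
    have h1 := (hPlip.lipschitzOnWith (s := Φ '' A)).euclideanHausdorffMeasure_image_le (n - 1)
    have h2 : P '' (Φ '' A) = A := by
      rw [image_image]; simp [hPΦ]
    rw [h2] at h1
    rw [hvol]
    simpa using h1
  have hle_vol : ∀ A ⊆ B, Measure.euclideanHausdorffMeasure (n - 1) (Φ '' A) ≤
      (K : ℝ≥0∞) ^ (n - 1) * volume A := fun A hA => by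
    rw [hvol]
    exact (hK.mono (hA.trans hBK)).euclideanHausdorffMeasure_image_le (n - 1)
  set J : (Submodule.span ℝ {e})ᗮ → ℝ≥0∞ := fun y => ENNReal.ofReal (N y) with hJ
  have hJm : Measurable J := hNc.measurable.ennreal_ofReal
  set σ₀ := (volume.restrict B).withDensity J with hσ₀
  have hσ₀app : ∀ A, MeasurableSet A → σ₀ A = ∫⁻ y in A ∩ B, J y := fun A hA => by
    rw [hσ₀, withDensity_apply _ hA, Measure.restrict_restrict hA]
  have hσ₀le : ∀ A, MeasurableSet A → σ₀ A ≤ M * volume (A ∩ B) := fun A hA => by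
    rw [hσ₀app A hA, ← setLIntegral_const]
    refine setLIntegral_mono' (hA.inter hBm) fun y hy => ?_
    have := ENNReal.ofReal_le_ofReal (hM y (hBK hy.2))
    simpa [hJ] using this
  have hσ₀ge : ∀ A, MeasurableSet A → volume (A ∩ B) ≤ σ₀ A := fun A hA => by
    rw [hσ₀app A hA, ← one_mul (volume (A ∩ B)), ← setLIntegral_const]
    refine setLIntegral_mono' (hA.inter hBm) fun y hy => ?_
    simpa [hJ] using hN1 y
  refine ⟨σ₀.map Φ, max M (K ^ (n - 1)), ?_, ?_, ?_, ?_⟩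
  · constructor
    rw [Measure.map_apply hΦc.measurable MeasurableSet.univ]
    refine (hσ₀le _ (hΦc.measurable MeasurableSet.univ)).trans_lt ?_
    refine ENNReal.mul_lt_top ENNReal.coe_lt_top ?_
    exact (measure_mono (inter_subset_right.trans hBK)).trans_lt hKcc.measure_lt_top
  · refine Measure.le_iff.2 fun A hA => ?_
    rw [Measure.map_apply hΦc.measurable hA, Measure.smul_apply, ENNReal.smul_def, smul_eq_mul,
      surfaceMeasure, Measure.restrict_apply hA]
    refine (hσ₀le _ (hΦc.measurable hA)).trans ?_
    gcongr
    · exact le_max_left _ _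
    · refine (hvol_le _).trans (measure_mono ?_)
      rintro _ ⟨y, hy, rfl⟩
      exact ⟨hy.1, hΦfr y hy.2⟩
  · refine Measure.le_iff.2 fun A hA => ?_
    rw [Measure.smul_apply, Measure.map_apply hΦc.measurable hA, ENNReal.smul_def, smul_eq_mul,
      surfaceMeasure, Measure.restrict_apply hA,
      Measure.restrict_apply (hA.inter Metric.isOpen_ball.measurableSet)]
    have hsub : A ∩ Metric.ball x₀ r ∩ frontier Ω ⊆ Φ '' (Φ ⁻¹' A ∩ B) := by
      rintro x ⟨⟨hxA, hxb⟩, hxf⟩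
      have := hΦP x ((h.mem_frontier_iff hΩ hxb).1 hxf)
      exact ⟨P x, ⟨by rwa [mem_preimage, this], by rwa [hB, mem_preimage, this]⟩, this⟩
    refine (measure_mono hsub).trans ((hle_vol _ inter_subset_right).trans ?_)
    refine mul_le_mul' ?_ (hσ₀ge _ (hΦc.measurable hA))
    exact_mod_cast le_max_right _ _
  · intro g hg hg0 w
    have hts : tsupport g ⊆ Metric.closedBall x₀ (r / 2) :=
      closure_minimal (fun x hx => by_contra fun h => hx (hg0 x h)) Metric.isClosed_closedBall
    have hball : Metric.closedBall x₀ (r / 2) ⊆ Metric.ball x₀ r :=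
      Metric.closedBall_subset_ball (half_lt_self h.r_pos)
    have hc : HasCompactSupport g := (isCompact_closedBall x₀ (r / 2)).of_isClosed_subset
      (isClosed_tsupport g) hts
    have hfc := (contDiff_graphDefiningFun hγ (e := e)).continuous
    -- the support of `g` lies in the ball, where `Ω` is the region above the graph
    have hgc : ContDiffOn ℝ 1 g {x | graphDefiningFun e γ x ≤ 0} := by
      intro x hx
      by_cases hxb : x ∈ Metric.ball x₀ r
      · refine (hg x ((h.mem_closure_iff hxb).2 hx)).mono_of_mem_nhdsWithin ?_
        filter_upwards [self_mem_nhdsWithin,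
          mem_nhdsWithin_of_mem_nhds (Metric.isOpen_ball.mem_nhds hxb)] with z hz hzb
        exact (h.mem_closure_iff hzb).2 hz
      · have h0 := notMem_tsupport_iff_eventuallyEq.1 fun hxt => hxb (hball (hts hxt))
        exact (contDiffAt_const.congr_of_eventuallyEq h0).contDiffWithinAt
    have hdz : ∀ x, x ∉ Metric.ball x₀ r → fderiv ℝ g x w = 0 := fun x hx => by
      rw [← fderivWithin_univ,
        fderivWithin_eq_zero_of_notMem_tsupport fun hxt => hx (hball (hts hxt))]; rfl
    have hset : ∫ x in Ω, fderiv ℝ g x w =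
        ∫ x in {x | graphDefiningFun e γ x < 0}, fderiv ℝ g x w := by
      rw [← integral_indicator hΩ.measurableSet,
        ← integral_indicator (isOpen_lt hfc continuous_const).measurableSet]
      congr 1
      funext x
      by_cases hxb : x ∈ Metric.ball x₀ r
      · by_cases hxΩ : x ∈ Ω
        · rw [indicator_of_mem hxΩ, indicator_of_mem]
          exact (h.mem_iff x hxb).1 hxΩ
        · rw [indicator_of_notMem hxΩ, indicator_of_notMem]
          exact fun hx => hxΩ ((h.mem_iff x hxb).2 hx)
      · simp [indicator, hdz x hxb]
    rw [hset, integral_fderiv_graph he hγ hgc hc w, hΦemb.integral_map, hσ₀,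
      integral_withDensity_eq_integral_toReal_smul hJm (by simp [hJ]),
      ← integral_indicator hBm]
    congr 1
    funext y
    by_cases hy : y ∈ B
    · rw [indicator_of_mem hy, h.fderiv_graphDefiningFun_eq hΩ hy (hΦfr y hy)]
      have hJy : (J y).toReal = N y := ENNReal.toReal_ofReal (zero_le_one.trans (hN1 y))
      rw [hJy, smul_eq_mul]
      simp only [hN, hΦ]
      ring
    · rw [indicator_of_notMem hy]
      have : g (Φ y) = 0 := hg0 _ fun h => hy (hball h)
      simp only [hΦ] at this
      rw [this, zero_mul]

end IsGraphChart

/-- Each point of the closure of `Ω` has a ball for which there is a measure as wanted; near an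
interior point it is zero. -/
theorem IsBoundedC2Domain.exists_local_measure (hΩ : IsBoundedC2Domain Ω)
    {x₀ : EuclideanSpace ℝ (Fin n)} (hx₀ : x₀ ∈ closure Ω) :
    ∃ r : ℝ, 0 < r ∧ ∃ (σ : Measure (EuclideanSpace ℝ (Fin n))) (C : ℝ≥0), IsFiniteMeasure σ ∧
      σ ≤ C • surfaceMeasure Ω ∧ (surfaceMeasure Ω).restrict (Metric.ball x₀ r) ≤ C • σ ∧
      ∀ g : EuclideanSpace ℝ (Fin n) → ℝ, ContDiffOn ℝ 1 g (closure Ω) →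
        (∀ x ∉ Metric.closedBall x₀ (r / 2), g x = 0) → ∀ w,
        ∫ x in Ω, fderiv ℝ g x w = ∫ x, g x * ⟪exteriorNormal Ω x, w⟫_ℝ ∂σ := by
  by_cases hxΩ : x₀ ∈ Ω
  · obtain ⟨r, hr, hrΩ⟩ := Metric.isOpen_iff.1 hΩ.isOpen x₀ hxΩ
    refine ⟨r, hr, 0, 0, inferInstance, by simp, ?_, fun g hg hg0 w => ?_⟩
    · have : Metric.ball x₀ r ∩ frontier Ω = ∅ := by
        rw [hΩ.isOpen.frontier_eq]
        ext x
        simp only [mem_inter_iff, Set.mem_sdiff, mem_empty_iff_false, iff_false]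
        exact fun h => h.2.2 (hrΩ h.1)
      rw [surfaceMeasure, Measure.restrict_restrict Metric.isOpen_ball.measurableSet, this]
      simp
    · have hts : tsupport g ⊆ Metric.closedBall x₀ (r / 2) :=
        closure_minimal (fun x hx => by_contra fun h => hx (hg0 x h)) Metric.isClosed_closedBall
      have hball : Metric.closedBall x₀ (r / 2) ⊆ Metric.ball x₀ r :=
        Metric.closedBall_subset_ball (half_lt_self hr)
      have hc : HasCompactSupport g := (isCompact_closedBall x₀ (r / 2)).of_isClosed_subset
        (isClosed_tsupport g) hts
      have hgc : ContDiff ℝ 1 g := by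
        rw [contDiff_iff_contDiffAt]
        intro x
        by_cases hxt : x ∈ tsupport g
        · exact hg.contDiffAt (mem_of_superset
            (hΩ.isOpen.mem_nhds (hrΩ (hball (hts hxt)))) subset_closure)
        · exact contDiffAt_const.congr_of_eventuallyEq (notMem_tsupport_iff_eventuallyEq.1 hxt)
      rw [integral_zero_measure, ← integral_fderiv_eq_zero_of_hasCompactSupport volume hgc hc w]
      refine setIntegral_eq_integral_of_forall_compl_eq_zero fun x hx => ?_
      rw [← fderivWithin_univ, fderivWithin_eq_zero_of_notMem_tsupport
        fun hxt => hx (hrΩ (hball (hts hxt)))]; rfl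
  · obtain ⟨r, e, γ, h⟩ := hΩ.exists_isGraphChart (x₀ := x₀)
      (by rw [hΩ.isOpen.frontier_eq]; exact ⟨hx₀, hxΩ⟩)
    exact ⟨r, h.r_pos, h.exists_measure hΩ.isOpen⟩

theorem IsBoundedC2Domain.isCompact_closure (hΩ : IsBoundedC2Domain Ω) : IsCompact (closure Ω) :=
  hΩ.isBounded.isCompact_closure

theorem IsBoundedC2Domain.isCompact_frontier (hΩ : IsBoundedC2Domain Ω) : IsCompact (frontier Ω) :=
  hΩ.isCompact_closure.of_isClosed_subset isClosed_frontier frontier_subset_closure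

theorem closure_mem_nhds_of_isOpen {X : Type*} [TopologicalSpace X] {s : Set X} (hs : IsOpen s)
    {x : X} (hx : x ∈ s) : closure s ∈ 𝓝 x :=
  mem_of_superset (hs.mem_nhds hx) subset_closure

theorem IsBoundedC2Domain.integrableOn_fderiv (hΩ : IsBoundedC2Domain Ω)
    {g : EuclideanSpace ℝ (Fin n) → ℝ} (hg : ContDiffOn ℝ 1 g (closure Ω))
    (w : EuclideanSpace ℝ (Fin n)) : IntegrableOn (fun x => fderiv ℝ g x w) Ω := by
  have hcont : ContinuousOn (fun x => fderivWithin ℝ g (closure Ω) x w) (closure Ω) :=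
    (hg.continuousOn_fderivWithin hΩ.uniqueDiffOn_closure le_rfl).clm_apply continuousOn_const
  refine ((hcont.integrableOn_compact hΩ.isCompact_closure).mono_set subset_closure).congr_fun
    (fun x hx => ?_) hΩ.isOpen.measurableSet
  dsimp only
  rw [fderivWithin_of_mem_nhds (closure_mem_nhds_of_isOpen hΩ.isOpen hx)]

/-- `σ` is a measure on the boundary of `Ω` for which the divergence theorem holds and which is
comparable, with constant `C`, to the surface measure. (The surface measure itself is such a
measure, but only comparability matters for estimates up to a constant.) -/
structure IsBoundaryMeasure (Ω : Set (EuclideanSpace ℝ (Fin n)))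
    (σ : Measure (EuclideanSpace ℝ (Fin n))) (C : ℝ≥0) : Prop where
  isFinite : IsFiniteMeasure σ
  le_surface : σ ≤ C • surfaceMeasure Ω
  surface_le : surfaceMeasure Ω ≤ C • σ
  integral_fderiv : ∀ g : EuclideanSpace ℝ (Fin n) → ℝ, ContDiffOn ℝ 1 g (closure Ω) →
    ∀ w, ∫ x in Ω, fderiv ℝ g x w = ∫ x, g x * ⟪exteriorNormal Ω x, w⟫_ℝ ∂σ

theorem ae_mem_frontier_of_le {σ : Measure (EuclideanSpace ℝ (Fin n))} {C : ℝ≥0}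
    (h : σ ≤ C • surfaceMeasure Ω) : ∀ᵐ x ∂σ, x ∈ frontier Ω := by
  refine (Measure.absolutelyContinuous_of_le_smul (c := (C : ℝ≥0∞)) h).ae_le ?_
  exact ae_restrict_mem isClosed_frontier.measurableSet

theorem IsBoundedC2Domain.integrable_of_continuousOn_frontier (hΩ : IsBoundedC2Domain Ω)
    {σ : Measure (EuclideanSpace ℝ (Fin n))} [IsFiniteMeasure σ] {C : ℝ≥0}
    (h : σ ≤ C • surfaceMeasure Ω) {F : EuclideanSpace ℝ (Fin n) → ℝ}
    (hF : ContinuousOn F (frontier Ω)) : Integrable F σ := by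
  rw [← Measure.restrict_eq_self_of_ae_mem (ae_mem_frontier_of_le h)]
  exact hF.integrableOn_compact hΩ.isCompact_frontier

/-- The local measures, glued with a partition of unity. -/
theorem IsBoundedC2Domain.exists_isBoundaryMeasure (hΩ : IsBoundedC2Domain Ω) :
    ∃ σ C, IsBoundaryMeasure Ω σ C := by
  choose! r hr σ C hσfin hσle hleσ hdiv using
    fun x (hx : x ∈ closure Ω) => hΩ.exists_local_measure hx
  have hbump : ∀ x ∈ closure Ω, ∃ f : EuclideanSpace ℝ (Fin n) → ℝ, ContDiff ℝ 1 f ∧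
      (∀ z, 0 ≤ f z) ∧ (∀ z, f z ≤ 1) ∧ (∀ z ∈ Metric.ball x (r x / 4), f z = 1) ∧
      ∀ z ∉ Metric.closedBall x (r x / 2), f z = 0 := fun x hx => by
    have hr0 := hr x hx
    let b : ContDiffBump x := ⟨r x / 4, r x / 2, by positivity, by linarith⟩
    refine ⟨b, b.contDiff, fun z => b.nonneg, fun z => b.le_one, fun z hz => ?_, fun z hz => ?_⟩
    · exact b.one_of_mem_closedBall (Metric.ball_subset_closedBall hz)
    · exact b.zero_of_le_dist (not_le.1 hz).le
  choose! f hfc hf0 hf1 hfone hfzero using hbump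
  obtain ⟨t, htΩ, ht⟩ := hΩ.isCompact_closure.elim_nhds_subcover
    (fun x => Metric.ball x (r x / 4))
    (fun x hx => Metric.ball_mem_nhds x (by have := hr x hx; positivity))
  -- the functions `f x / S` with `x ∈ t` are a partition of unity on the closure of `Ω`
  set S : EuclideanSpace ℝ (Fin n) → ℝ := fun z => ∑ x ∈ t, f x z with hS
  have hSc : ContDiff ℝ 1 S := ContDiff.sum fun x hx => hfc x (htΩ x hx)
  have hfS : ∀ x ∈ t, ∀ z, f x z ≤ S z := fun x hx z =>
    Finset.single_le_sum (f := fun x => f x z) (fun y hy => hf0 y (htΩ y hy) z) hx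
  have hS0 : ∀ z, 0 ≤ S z := fun z => Finset.sum_nonneg fun y hy => hf0 y (htΩ y hy) z
  have hS1 : ∀ z ∈ closure Ω, 1 ≤ S z := fun z hz => by
    obtain ⟨x, hx, hzx⟩ := mem_iUnion₂.1 (ht hz)
    exact (hfone x (htΩ x hx) z hzx).symm.le.trans (hfS x hx z)
  have hSN : ∀ z, S z ≤ t.card := fun z => by
    have := Finset.sum_le_card_nsmul t (fun x => f x z) 1 fun x hx => hf1 x (htΩ x hx) z
    simpa using this
  set d : EuclideanSpace ℝ (Fin n) → EuclideanSpace ℝ (Fin n) → ℝ≥0∞ :=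
    fun x z => ENNReal.ofReal (f x z / S z) with hd
  have hdm : ∀ x ∈ t, Measurable (d x) := fun x hx =>
    ((hfc x (htΩ x hx)).continuous.measurable.div hSc.continuous.measurable).ennreal_ofReal
  have hd1 : ∀ x ∈ t, ∀ z, d x z ≤ 1 := fun x hx z =>
    ENNReal.ofReal_le_one.2 (div_le_one_of_le₀ (hfS x hx z) (hS0 z))
  set τ := fun x => (σ x).withDensity (d x) with hτ
  have hτσ : ∀ x ∈ t, τ x ≤ σ x := fun x hx => by
    refine (withDensity_mono (Eventually.of_forall (hd1 x hx))).trans ?_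
    exact (withDensity_one (μ := σ x)).le
  have hle : ∑ x ∈ t, τ x ≤ (∑ x ∈ t, C x) • surfaceMeasure Ω := by
    rw [Finset.sum_smul]
    exact Finset.sum_le_sum fun x hx => (hτσ x hx).trans (hσle x (htΩ x hx))
  have hfin : ∀ x ∈ t, IsFiniteMeasure (τ x) := fun x hx => by
    have := hσfin x (htΩ x hx)
    exact isFiniteMeasure_of_le (σ x) (hτσ x hx)
  refine ⟨∑ x ∈ t, τ x, max (∑ x ∈ t, C x) (∑ x ∈ t, C x * t.card), ?_, ?_, ?_, ?_⟩
  · constructor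
    rw [Measure.coe_finsetSum, Finset.sum_apply]
    exact ENNReal.sum_lt_top.2 fun x hx => (hfin x hx).measure_univ_lt_top
  · refine hle.trans ?_
    gcongr
    exact le_max_left _ _
  · refine Measure.le_iff.2 fun A hA => ?_
    have hsub : A ∩ frontier Ω ⊆ ⋃ x ∈ t, A ∩ Metric.ball x (r x / 4) ∩ frontier Ω := by
      rintro z ⟨hzA, hz⟩
      obtain ⟨x, hx, hzx⟩ := mem_iUnion₂.1 (ht (frontier_subset_closure hz))
      exact mem_iUnion₂.2 ⟨x, hx, ⟨hzA, hzx⟩, hz⟩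
    have hstep : ∀ x ∈ t, surfaceMeasure Ω (A ∩ Metric.ball x (r x / 4)) ≤
        (C x * t.card : ℝ≥0) * (∑ y ∈ t, τ y) A := fun x hx => by
      have hr0 := hr x (htΩ x hx)
      have hAm : MeasurableSet (A ∩ Metric.ball x (r x / 4)) :=
        hA.inter Metric.isOpen_ball.measurableSet
      have h1 := Measure.le_iff.1 (hleσ x (htΩ x hx)) _ hAm
      rw [Measure.restrict_apply hAm, inter_eq_self_of_subset_left (inter_subset_right.trans
        (Metric.ball_subset_ball (by linarith))), Measure.smul_apply, ENNReal.smul_def,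
        smul_eq_mul] at h1
      refine h1.trans ?_
      rw [ENNReal.coe_mul, mul_assoc]
      gcongr
      have h2 : σ x (A ∩ Metric.ball x (r x / 4)) ≤ t.card * τ x A := by
        have hfr := ae_mem_frontier_of_le (hσle x (htΩ x hx))
        have h3 : τ x (A ∩ Metric.ball x (r x / 4)) =
            ∫⁻ z in A ∩ Metric.ball x (r x / 4), d x z ∂(σ x) := withDensity_apply _ hAm
        have h4 : t.card * τ x (A ∩ Metric.ball x (r x / 4)) ≤ t.card * τ x A := by
          gcongr
          exact inter_subset_left
        refine le_trans ?_ h4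
        rw [h3, ← lintegral_const_mul _ (hdm x hx), ← one_mul (σ x _), ← setLIntegral_const]
        refine setLIntegral_mono_ae ((hdm x hx).const_mul _).aemeasurable ?_
        filter_upwards [hfr] with z hzf hz
        have hS1z := hS1 z (frontier_subset_closure hzf)
        rw [hd]
        dsimp only
        rw [hfone x (htΩ x hx) z hz.2, ← ENNReal.ofReal_natCast,
          ← ENNReal.ofReal_mul (by positivity), ENNReal.one_le_ofReal, mul_one_div,
          one_le_div (by linarith)]
        exact hSN z
      refine h2.trans ?_
      rw [ENNReal.coe_natCast]
      gcongr
      exact Finset.single_le_sum (f := τ) (fun _ _ => Measure.zero_le _) hx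
    have hsum : surfaceMeasure Ω A ≤ ∑ x ∈ t, surfaceMeasure Ω (A ∩ Metric.ball x (r x / 4)) := by
      rw [surfaceMeasure, Measure.restrict_apply hA]
      refine (measure_mono hsub).trans ((measure_biUnion_finset_le _ _).trans ?_)
      refine Finset.sum_le_sum fun x hx => ?_
      rw [Measure.restrict_apply (hA.inter Metric.isOpen_ball.measurableSet)]
    refine hsum.trans ((Finset.sum_le_sum hstep).trans ?_)
    rw [← Finset.sum_mul, Measure.smul_apply, ENNReal.smul_def, smul_eq_mul,
      ← ENNReal.ofNNReal_finsetSum]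
    gcongr
    exact le_max_right _ _
  · intro g hg w
    have hgS : ContDiffOn ℝ 1 (fun z => g z / S z) (closure Ω) :=
      hg.div hSc.contDiffOn fun z hz => (one_pos.trans_le (hS1 z hz)).ne'
    have hgx : ∀ x ∈ t, ContDiffOn ℝ 1 (fun z => f x z * (g z / S z)) (closure Ω) := fun x hx =>
      (hfc x (htΩ x hx)).contDiffOn.mul hgS
    have hsumg : ∀ z ∈ Ω,
        fderiv ℝ g z w = ∑ x ∈ t, fderiv ℝ (fun z => f x z * (g z / S z)) z w := by
      intro z hz
      have hev : g =ᶠ[𝓝 z] fun z => ∑ x ∈ t, f x z * (g z / S z) := by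
        filter_upwards [hΩ.isOpen.mem_nhds hz] with y hy
        have hy1 := hS1 y (subset_closure hy)
        rw [← Finset.sum_mul]
        exact (mul_div_cancel₀ _ (one_pos.trans_le hy1).ne').symm
      rw [hev.fderiv_eq, fderiv_fun_sum fun x hx => ((hgx x hx).contDiffAt
        (closure_mem_nhds_of_isOpen hΩ.isOpen hz)).differentiableAt (by norm_num)]
      simp
    rw [setIntegral_congr_fun hΩ.isOpen.measurableSet hsumg,
      integral_finsetSum _ fun x hx => hΩ.integrableOn_fderiv (hgx x hx) w,
      integral_finsetSum_measure fun x hx => ?_]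
    · refine Finset.sum_congr rfl fun x hx => ?_
      rw [hdiv x (htΩ x hx) _ (hgx x hx)
        (fun z hz => by rw [hfzero x (htΩ x hx) z hz, zero_mul]) w, hτ]
      dsimp only
      rw [integral_withDensity_eq_integral_toReal_smul (hdm x hx) (by simp [hd])]
      congr 1
      funext z
      have : (d x z).toReal = f x z / S z :=
        ENNReal.toReal_ofReal (div_nonneg (hf0 x (htΩ x hx) z) (hS0 z))
      rw [this, smul_eq_mul]
      ring
    · have := hfin x hx
      exact hΩ.integrable_of_continuousOn_frontier ((hτσ x hx).trans (hσle x (htΩ x hx)))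
        ((hg.continuousOn.mono frontier_subset_closure).mul
          (hΩ.continuousOn_exteriorNormal.inner continuousOn_const))

end BoundaryMeasure

/-! ### Calculus on the closed cylinder -/

section Cylinder

variable {n : ℕ} {Ω : Set (EuclideanSpace ℝ (Fin n))} {T : ℝ}

/-- The closed cylinder `Ω̄ × [0,T]`. -/
def closedCylinder (Ω : Set (EuclideanSpace ℝ (Fin n))) (T : ℝ) :
    Set (EuclideanSpace ℝ (Fin n) × ℝ) :=
  closure Ω ×ˢ Icc 0 T

/-- The derivative of `v` at `p` along the space-time direction `d`, one-sided on the boundary of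
the closed cylinder. -/
def cylDeriv (Ω : Set (EuclideanSpace ℝ (Fin n))) (T : ℝ) (v : EuclideanSpace ℝ (Fin n) × ℝ → ℝ)
    (d p : EuclideanSpace ℝ (Fin n) × ℝ) : ℝ :=
  fderivWithin ℝ v (closedCylinder Ω T) p d

theorem isCompact_closedCylinder (hΩ : IsBoundedC2Domain Ω) : IsCompact (closedCylinder Ω T) :=
  hΩ.isCompact_closure.prod isCompact_Icc

theorem uniqueDiffOn_closedCylinder (hΩ : IsBoundedC2Domain Ω) (hT : 0 < T) :
    UniqueDiffOn ℝ (closedCylinder Ω T) :=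
  hΩ.uniqueDiffOn_closure.prod (uniqueDiffOn_Icc hT)

theorem cylinder_subset_closedCylinder : cylinder Ω T ⊆ closedCylinder Ω T :=
  prod_mono subset_closure Ioo_subset_Icc_self

theorem isOpen_cylinder (hΩ : IsBoundedC2Domain Ω) : IsOpen (cylinder Ω T) :=
  hΩ.isOpen.prod isOpen_Ioo

theorem closedCylinder_mem_nhds (hΩ : IsBoundedC2Domain Ω) {p : EuclideanSpace ℝ (Fin n) × ℝ}
    (hp : p ∈ cylinder Ω T) : closedCylinder Ω T ∈ 𝓝 p :=
  mem_of_superset ((isOpen_cylinder hΩ).mem_nhds hp) cylinder_subset_closedCylinder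

variable {v f g : EuclideanSpace ℝ (Fin n) × ℝ → ℝ} {d d' p : EuclideanSpace ℝ (Fin n) × ℝ}

theorem cylDeriv_eq_fderiv (hΩ : IsBoundedC2Domain Ω) (hp : p ∈ cylinder Ω T) :
    cylDeriv Ω T v d p = fderiv ℝ v p d := by
  rw [cylDeriv, fderivWithin_of_mem_nhds (closedCylinder_mem_nhds hΩ hp)]

theorem cylDeriv_add_dir : cylDeriv Ω T v (d + d') p = cylDeriv Ω T v d p + cylDeriv Ω T v d' p :=
  map_add _ _ _

theorem cylDeriv_smul_dir (c : ℝ) : cylDeriv Ω T v (c • d) p = c * cylDeriv Ω T v d p :=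
  map_smul _ _ _

theorem contDiffOn_cylDeriv (hΩ : IsBoundedC2Domain Ω) (hT : 0 < T)
    (hv : ContDiffOn ℝ 2 v (closedCylinder Ω T)) :
    ContDiffOn ℝ 1 (cylDeriv Ω T v d) (closedCylinder Ω T) :=
  (hv.fderivWithin (uniqueDiffOn_closedCylinder hΩ hT) (by norm_num)).clm_apply contDiffOn_const

theorem continuousOn_cylDeriv (hΩ : IsBoundedC2Domain Ω) (hT : 0 < T)
    (hv : ContDiffOn ℝ 1 v (closedCylinder Ω T)) :
    ContinuousOn (cylDeriv Ω T v d) (closedCylinder Ω T) :=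
  (hv.continuousOn_fderivWithin (uniqueDiffOn_closedCylinder hΩ hT) le_rfl).clm_apply
    continuousOn_const

theorem cylDeriv_mul (hΩ : IsBoundedC2Domain Ω) (hT : 0 < T)
    (hf : ContDiffOn ℝ 1 f (closedCylinder Ω T)) (hg : ContDiffOn ℝ 1 g (closedCylinder Ω T))
    (hp : p ∈ closedCylinder Ω T) :
    cylDeriv Ω T (fun p => f p * g p) d p =
      f p * cylDeriv Ω T g d p + cylDeriv Ω T f d p * g p := by
  unfold cylDeriv
  rw [fderivWithin_fun_mul (uniqueDiffOn_closedCylinder hΩ hT p hp)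
    ((hf p hp).differentiableWithinAt (by norm_num))
    ((hg p hp).differentiableWithinAt (by norm_num))]
  simp [mul_comm]

theorem cylDeriv_comm (hΩ : IsBoundedC2Domain Ω)
    (hv : ContDiffOn ℝ 2 v (closedCylinder Ω T)) (hp : p ∈ cylinder Ω T) :
    cylDeriv Ω T (cylDeriv Ω T v d) d' p = cylDeriv Ω T (cylDeriv Ω T v d') d p := by
  have hvat : ContDiffAt ℝ 2 v p := hv.contDiffAt (closedCylinder_mem_nhds hΩ hp)
  have hdiff : DifferentiableAt ℝ (fderiv ℝ v) p :=
    (hvat.fderiv_right (m := 1) (by norm_num)).differentiableAt (by norm_num)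
  have key : ∀ a b, cylDeriv Ω T (cylDeriv Ω T v a) b p = fderiv ℝ (fderiv ℝ v) p b a := by
    intro a b
    rw [cylDeriv_eq_fderiv hΩ hp]
    have hev : cylDeriv Ω T v a =ᶠ[𝓝 p] fun z => fderiv ℝ v z a := by
      filter_upwards [(isOpen_cylinder hΩ).mem_nhds hp] with z hz using cylDeriv_eq_fderiv hΩ hz
    rw [hev.fderiv_eq, fderiv_clm_apply hdiff (differentiableAt_const a)]
    simp
  rw [key, key]
  exact (hvat.isSymmSndFDerivAt (by simp)) d' d

theorem hasFDerivWithinAt_slice (hv : DifferentiableWithinAt ℝ v (closedCylinder Ω T) p)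
    (hp : p ∈ closedCylinder Ω T) :
    HasFDerivWithinAt (fun y => v (y, p.2))
      ((fderivWithin ℝ v (closedCylinder Ω T) p).comp (ContinuousLinearMap.inl ℝ _ ℝ))
      (closure Ω) p.1 :=
  HasFDerivWithinAt.comp p.1 (f := fun y => (y, p.2)) hv.hasFDerivWithinAt
    (hasFDerivAt_prodMk_left p.1 p.2).hasFDerivWithinAt fun _ hy => ⟨hy, hp.2⟩

theorem cylDeriv_eq_fderivWithin_slice (hΩ : IsBoundedC2Domain Ω)
    (hv : DifferentiableWithinAt ℝ v (closedCylinder Ω T) p) (hp : p ∈ closedCylinder Ω T)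
    (w : EuclideanSpace ℝ (Fin n)) :
    cylDeriv Ω T v (w, 0) p = fderivWithin ℝ (fun y => v (y, p.2)) (closure Ω) p.1 w := by
  rw [(hasFDerivWithinAt_slice hv hp).fderivWithin (hΩ.uniqueDiffOn_closure p.1 hp.1)]
  simp [cylDeriv]

theorem hasDerivWithinAt_slice_time (hv : DifferentiableWithinAt ℝ v (closedCylinder Ω T) p)
    (hp : p ∈ closedCylinder Ω T) :
    HasDerivWithinAt (fun s => v (p.1, s)) (cylDeriv Ω T v (0, 1) p) (Icc 0 T) p.2 := by
  have := HasFDerivWithinAt.comp p.2 (f := fun s : ℝ => (p.1, s)) hv.hasFDerivWithinAt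
    (hasFDerivAt_prodMk_right p.1 p.2).hasFDerivWithinAt
    (fun s (hs : s ∈ Icc 0 T) => (⟨hp.1, hs⟩ : (p.1, s) ∈ closedCylinder Ω T))
  simpa [Function.comp_def, cylDeriv] using this.hasDerivWithinAt

theorem contDiffOn_slice {m : WithTop ℕ∞} (hv : ContDiffOn ℝ m v (closedCylinder Ω T)) {t : ℝ}
    (ht : t ∈ Icc 0 T) : ContDiffOn ℝ m (fun y => v (y, t)) (closure Ω) :=
  hv.comp (contDiff_id.prodMk contDiff_const).contDiffOn fun _ hy => ⟨hy, ht⟩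

theorem integrableOn_cylinder (hΩ : IsBoundedC2Domain Ω)
    (hf : ContinuousOn f (closedCylinder Ω T)) : IntegrableOn f (cylinder Ω T) :=
  (hf.integrableOn_compact (isCompact_closedCylinder hΩ)).mono_set cylinder_subset_closedCylinder

theorem integrableOn_slice (hΩ : IsBoundedC2Domain Ω) (hf : ContinuousOn f (closedCylinder Ω T))
    {t : ℝ} (ht : t ∈ Icc 0 T) : IntegrableOn (fun x => f (x, t)) Ω :=
  ((hf.comp (by fun_prop) fun _ hx => ⟨hx, ht⟩ :
    ContinuousOn (fun x => f (x, t)) (closure Ω)).integrableOn_compact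
      hΩ.isCompact_closure).mono_set subset_closure

/-- The measure `dσ dt` on the lateral boundary. -/
def lateralMeasure (T : ℝ) (σ : Measure (EuclideanSpace ℝ (Fin n))) :
    Measure (EuclideanSpace ℝ (Fin n) × ℝ) :=
  σ.prod (volume.restrict (Ioo 0 T))

variable {σ : Measure (EuclideanSpace ℝ (Fin n))} {C : ℝ≥0}

theorem IsBoundaryMeasure.ae_lateralMeasure (hσ : IsBoundaryMeasure Ω σ C) :
    ∀ᵐ p ∂(lateralMeasure T σ), p ∈ frontier Ω ×ˢ Ioo 0 T := by
  have := hσ.isFinite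
  have h1 := ae_mem_frontier_of_le hσ.le_surface
  have h2 : ∀ᵐ t ∂((volume : Measure ℝ).restrict (Ioo 0 T)), t ∈ Ioo 0 T :=
    ae_restrict_mem measurableSet_Ioo
  filter_upwards [Measure.quasiMeasurePreserving_fst.ae h1,
    Measure.quasiMeasurePreserving_snd.ae h2] with p hp1 hp2 using ⟨hp1, hp2⟩

theorem IsBoundaryMeasure.integrable_lateralMeasure (hσ : IsBoundaryMeasure Ω σ C)
    (hΩ : IsBoundedC2Domain Ω) (hf : ContinuousOn f (frontier Ω ×ˢ Icc 0 T)) :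
    Integrable f (lateralMeasure T σ) := by
  have := hσ.isFinite
  have hfin : IsFiniteMeasure (lateralMeasure T σ) := by unfold lateralMeasure; infer_instance
  rw [← Measure.restrict_eq_self_of_ae_mem (s := frontier Ω ×ˢ Icc 0 T)
    (μ := lateralMeasure T σ)]
  · exact hf.integrableOn_compact (hΩ.isCompact_frontier.prod isCompact_Icc)
  · filter_upwards [hσ.ae_lateralMeasure (T := T)] with p hp using
      ⟨hp.1, Ioo_subset_Icc_self hp.2⟩

theorem frontier_prod_subset : frontier Ω ×ˢ Icc 0 T ⊆ closedCylinder Ω T :=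
  prod_mono_left frontier_subset_closure

/-- The divergence theorem on the cylinder, for a derivative in space. -/
theorem IsBoundaryMeasure.integral_cylDeriv_space (hσ : IsBoundaryMeasure Ω σ C)
    (hΩ : IsBoundedC2Domain Ω) (hT : 0 < T) (hg : ContDiffOn ℝ 1 g (closedCylinder Ω T))
    (w : EuclideanSpace ℝ (Fin n)) :
    ∫ p in cylinder Ω T, cylDeriv Ω T g (w, 0) p =
      ∫ p, g p * ⟪exteriorNormal Ω p.1, w⟫_ℝ ∂(lateralMeasure T σ) := by
  have := hσ.isFinite
  have hi1 := integrableOn_cylinder hΩ (continuousOn_cylDeriv (d := (w, 0)) hΩ hT hg)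
  have hi2 : Integrable (fun p => g p * ⟪exteriorNormal Ω p.1, w⟫_ℝ) (lateralMeasure T σ) :=
    hσ.integrable_lateralMeasure hΩ ((hg.continuousOn.mono frontier_prod_subset).mul
      ((hΩ.continuousOn_exteriorNormal.comp continuousOn_fst fun p hp => hp.1).inner
        continuousOn_const))
  rw [lateralMeasure, integral_prod_symm _ hi2]
  rw [IntegrableOn, cylinder, Measure.volume_eq_prod, ← Measure.prod_restrict] at hi1
  rw [cylinder, Measure.volume_eq_prod, ← Measure.prod_restrict, integral_prod_symm _ hi1]
  refine setIntegral_congr_fun measurableSet_Ioo fun t ht => ?_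
  have ht' := Ioo_subset_Icc_self ht
  rw [← hσ.integral_fderiv _ (contDiffOn_slice hg ht') w]
  refine setIntegral_congr_fun hΩ.isOpen.measurableSet fun x hx => ?_
  have hp : (x, t) ∈ closedCylinder Ω T := ⟨subset_closure hx, ht'⟩
  rw [cylDeriv_eq_fderivWithin_slice hΩ ((hg _ hp).differentiableWithinAt (by norm_num)) hp,
    fderivWithin_of_mem_nhds (closure_mem_nhds_of_isOpen hΩ.isOpen hx)]

theorem integral_cylDeriv_time (hΩ : IsBoundedC2Domain Ω) (hT : 0 < T)
    (hg : ContDiffOn ℝ 1 g (closedCylinder Ω T)) :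
    ∫ p in cylinder Ω T, cylDeriv Ω T g (0, 1) p = ∫ x in Ω, (g (x, T) - g (x, 0)) := by
  have hc := continuousOn_cylDeriv (d := (0, 1)) hΩ hT hg
  have hi1 := integrableOn_cylinder hΩ hc
  rw [Measure.volume_eq_prod] at hi1 ⊢
  rw [cylinder, setIntegral_prod _ hi1]
  refine setIntegral_congr_fun hΩ.isOpen.measurableSet fun x hx => ?_
  have hK : ∀ t ∈ Icc 0 T, (x, t) ∈ closedCylinder Ω T := fun t ht => ⟨subset_closure hx, ht⟩
  have hd : ∀ t ∈ Icc 0 T, HasDerivWithinAt (fun s => g (x, s)) (cylDeriv Ω T g (0, 1) (x, t))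
      (Icc 0 T) t := fun t ht =>
    hasDerivWithinAt_slice_time (p := (x, t)) ((hg _ (hK t ht)).differentiableWithinAt
      (by norm_num)) (hK t ht)
  rw [← integral_Ioc_eq_integral_Ioo, ← intervalIntegral.integral_of_le hT.le]
  refine intervalIntegral.integral_eq_sub_of_hasDerivAt_of_le hT.le
    (fun t ht => (hd t ht).continuousWithinAt)
    (fun t ht => (hd t (Ioo_subset_Icc_self ht)).hasDerivAt (Icc_mem_nhds ht.1 ht.2)) ?_
  refine ContinuousOn.intervalIntegrable ?_
  rw [uIcc_of_le hT.le]
  exact hc.comp (f := fun t : ℝ => (x, t)) (by fun_prop) hK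

/-- A function that vanishes on the lateral boundary has no tangential derivative there. -/
theorem cylDeriv_lateral_space (hΩ : IsBoundedC2Domain Ω)
    (hv : DifferentiableWithinAt ℝ v (closedCylinder Ω T) p) (hp : p ∈ frontier Ω ×ˢ Ioo 0 T)
    (hv0 : ∀ x ∈ frontier Ω, ∀ t ∈ Ioo 0 T, v (x, t) = 0) (w : EuclideanSpace ℝ (Fin n)) :
    cylDeriv Ω T v (w, 0) p =
      cylDeriv Ω T v (exteriorNormal Ω p.1, 0) p * ⟪exteriorNormal Ω p.1, w⟫_ℝ := by
  set ν := exteriorNormal Ω p.1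
  have hpK : p ∈ closedCylinder Ω T :=
    ⟨frontier_subset_closure hp.1, Ioo_subset_Icc_self hp.2⟩
  obtain ⟨r, e, γ, h⟩ := hΩ.exists_isGraphChart hp.1
  have hpb := Metric.mem_ball_self h.r_pos (x := p.1)
  have htan : ∀ w, ⟪ν, w⟫_ℝ = 0 → cylDeriv Ω T v (w, 0) p = 0 := by
    intro w hw
    have hf0 := h.fderiv_graphDefiningFun_eq hΩ.isOpen hpb hp.1 w
    rw [hw, mul_zero, fderiv_graphDefiningFun_apply h.contDiff, sub_eq_zero] at hf0
    set P := (Submodule.span ℝ {e})ᗮ.orthogonalProjectionOnto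
    -- a curve in the boundary with velocity `w`
    set c : ℝ → EuclideanSpace ℝ (Fin n) := fun s => graphCoord e γ (P p.1 + s • P w, 0) with hc
    have hc0 : c 0 = p.1 := by
      have := graphCoord_proj h.norm_e p.1 (γ := γ)
      rw [(h.mem_frontier_iff hΩ.isOpen hpb).1 hp.1, neg_zero] at this
      simpa [hc] using this
    have hl : HasDerivAt (fun s : ℝ => P p.1 + s • P w) (P w) 0 := by
      simpa using ((hasDerivAt_id (0 : ℝ)).smul_const (P w)).const_add (P p.1)
    have hγd : HasDerivAt (fun s : ℝ => γ (P p.1 + s • P w)) (fderiv ℝ γ (P p.1) (P w)) 0 := by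
      have h1 : HasFDerivAt γ (fderiv ℝ γ (P p.1)) (P p.1 + (0 : ℝ) • P w) := by
        rw [zero_smul, add_zero]
        exact (h.contDiff.differentiable (by norm_num)).differentiableAt.hasFDerivAt
      exact h1.comp_hasDerivAt 0 hl
    have hcd : HasDerivAt c w 0 := by
      have h1 := ((Submodule.span ℝ {e})ᗮ.subtypeL.hasFDerivAt.comp_hasDerivAt (0 : ℝ) hl).add
        (hγd.smul_const e)
      have h2 : (Submodule.span ℝ {e})ᗮ.subtypeL (P w) + fderiv ℝ γ (P p.1) (P w) • e = w := by
        rw [hf0]; exact proj_add_inner_smul h.norm_e w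
      rw [h2] at h1
      refine h1.congr_of_eventuallyEq (Eventually.of_forall fun s => ?_)
      simp [hc, graphCoord]
    have hcf : ∀ᶠ s in 𝓝 (0 : ℝ), c s ∈ frontier Ω := by
      have hb : Metric.ball p.1 r ∈ 𝓝 (c 0) := by
        rw [hc0]; exact Metric.isOpen_ball.mem_nhds hpb
      filter_upwards [hcd.continuousAt hb] with s hs
      rw [h.mem_frontier_iff hΩ.isOpen hs, hc]
      dsimp only
      rw [graphDefiningFun_graphCoord h.norm_e]
      simp
    have hs := hasFDerivWithinAt_slice hv hpK
    rw [← hc0] at hs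
    have h3 := hs.comp_hasDerivAt (0 : ℝ) hcd (hcf.mono fun s hs => frontier_subset_closure hs)
    have h4 : HasDerivAt ((fun y => v (y, p.2)) ∘ c) 0 (0 : ℝ) := by
      refine (hasDerivAt_const (0 : ℝ) (0 : ℝ)).congr_of_eventuallyEq ?_
      filter_upwards [hcf] with s hs using hv0 _ hs _ hp.2
    have h5 := h3.unique h4
    simpa [cylDeriv] using h5
  have hν1 : ⟪ν, ν⟫_ℝ = 1 := by
    rw [real_inner_self_eq_norm_sq, (hΩ.isExteriorUnitNormal hp.1).1]; norm_num
  have h1 := htan (w - ⟪ν, w⟫_ℝ • ν) (by rw [inner_sub_right, inner_smul_right, hν1]; ring)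
  have h2 : ((w, 0) : EuclideanSpace ℝ (Fin n) × ℝ) =
      (w - ⟪ν, w⟫_ℝ • ν, 0) + ⟪ν, w⟫_ℝ • (ν, 0) := by simp
  rw [h2, cylDeriv_add_dir, h1, cylDeriv_smul_dir]
  ring

theorem cylDeriv_lateral_time
    (hv : DifferentiableWithinAt ℝ v (closedCylinder Ω T) p) (hp : p ∈ frontier Ω ×ˢ Ioo 0 T)
    (hv0 : ∀ x ∈ frontier Ω, ∀ t ∈ Ioo 0 T, v (x, t) = 0) :
    cylDeriv Ω T v (0, 1) p = 0 := by
  have hpK : p ∈ closedCylinder Ω T :=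
    ⟨frontier_subset_closure hp.1, Ioo_subset_Icc_self hp.2⟩
  have h1 := (hasDerivWithinAt_slice_time hv hpK).hasDerivAt (Icc_mem_nhds hp.2.1 hp.2.2)
  have h2 : HasDerivAt (fun s => v (p.1, s)) 0 p.2 := by
    refine (hasDerivAt_const p.2 (0 : ℝ)).congr_of_eventuallyEq ?_
    filter_upwards [isOpen_Ioo.mem_nhds hp.2] with s hs using hv0 _ hp.1 _ hs
  exact h1.unique h2

theorem cylDeriv_eq_zero_of_slice_eq_zero (hΩ : IsBoundedC2Domain Ω)
    (hv : DifferentiableWithinAt ℝ v (closedCylinder Ω T) p) (hp : p ∈ Ω ×ˢ Icc 0 T)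
    (hv0 : ∀ x ∈ Ω, v (x, p.2) = 0) (w : EuclideanSpace ℝ (Fin n)) :
    cylDeriv Ω T v (w, 0) p = 0 := by
  rw [cylDeriv_eq_fderivWithin_slice hΩ hv ⟨subset_closure hp.1, hp.2⟩,
    fderivWithin_of_mem_nhds (closure_mem_nhds_of_isOpen hΩ.isOpen hp.1)]
  have : (fun y => v (y, p.2)) =ᶠ[𝓝 p.1] fun _ => 0 := by
    filter_upwards [hΩ.isOpen.mem_nhds hp.1] with y hy using hv0 y hy
  rw [this.fderiv_eq]
  simp

end Cylinder

/-! ### The estimate for the conjugated operator -/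

section ConjugatedOperator

variable {n : ℕ} {Ω : Set (EuclideanSpace ℝ (Fin n))} {T : ℝ}

/-- The Laplacian in the space variable, in terms of `cylDeriv`. -/
def cylLaplacian (Ω : Set (EuclideanSpace ℝ (Fin n))) (T : ℝ)
    (v : EuclideanSpace ℝ (Fin n) × ℝ → ℝ) (p : EuclideanSpace ℝ (Fin n) × ℝ) : ℝ :=
  ∑ i, cylDeriv Ω T (cylDeriv Ω T v (EuclideanSpace.single i 1, 0)) (EuclideanSpace.single i 1, 0) p

/-- The operator `ε (∂_t - 2 ρ ω · ∇) - Δ`, which is `ε ∂_t - Δ` conjugated with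
`exp (ε (ρ ω · x + ρ² t))`. -/
def conjugatedOp (Ω : Set (EuclideanSpace ℝ (Fin n))) (T ε : ℝ) (ω : EuclideanSpace ℝ (Fin n))
    (ρ : ℝ) (v : EuclideanSpace ℝ (Fin n) × ℝ → ℝ) (p : EuclideanSpace ℝ (Fin n) × ℝ) : ℝ :=
  ε * cylDeriv Ω T v (-(2 * ρ) • ω, 1) p - cylLaplacian Ω T v p

/-- The derivative along the exterior normal of `Ω`, on the lateral boundary. -/
def lateralNormalDeriv (Ω : Set (EuclideanSpace ℝ (Fin n))) (T : ℝ)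
    (v : EuclideanSpace ℝ (Fin n) × ℝ → ℝ) (p : EuclideanSpace ℝ (Fin n) × ℝ) : ℝ :=
  cylDeriv Ω T v (exteriorNormal Ω p.1, 0) p

variable {v : EuclideanSpace ℝ (Fin n) × ℝ → ℝ} {σ : Measure (EuclideanSpace ℝ (Fin n))} {C : ℝ≥0}
  {ω : EuclideanSpace ℝ (Fin n)} {ε ρ : ℝ}

theorem continuousOn_cylLaplacian (hΩ : IsBoundedC2Domain Ω) (hT : 0 < T)
    (hv : ContDiffOn ℝ 2 v (closedCylinder Ω T)) :
    ContinuousOn (cylLaplacian Ω T v) (closedCylinder Ω T) :=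
  continuousOn_finsetSum _ fun _ _ => continuousOn_cylDeriv hΩ hT (contDiffOn_cylDeriv hΩ hT hv)

theorem continuousOn_conjugatedOp (hΩ : IsBoundedC2Domain Ω) (hT : 0 < T)
    (hv : ContDiffOn ℝ 2 v (closedCylinder Ω T)) :
    ContinuousOn (conjugatedOp Ω T ε ω ρ v) (closedCylinder Ω T) :=
  (continuousOn_const.mul (continuousOn_cylDeriv hΩ hT (hv.of_le (by norm_num)))).sub
    (continuousOn_cylLaplacian hΩ hT hv)

theorem continuousOn_exteriorNormal_fst (hΩ : IsBoundedC2Domain Ω) :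
    ContinuousOn (fun p : EuclideanSpace ℝ (Fin n) × ℝ => exteriorNormal Ω p.1)
      (frontier Ω ×ˢ Icc 0 T) :=
  hΩ.continuousOn_exteriorNormal.comp continuousOn_fst fun _ hp => hp.1

theorem continuousOn_lateralNormalDeriv (hΩ : IsBoundedC2Domain Ω) (hT : 0 < T)
    (hv : ContDiffOn ℝ 1 v (closedCylinder Ω T)) :
    ContinuousOn (lateralNormalDeriv Ω T v) (frontier Ω ×ˢ Icc 0 T) :=
  ((hv.continuousOn_fderivWithin (uniqueDiffOn_closedCylinder hΩ hT) le_rfl).mono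
    frontier_prod_subset).clm_apply
      ((continuousOn_exteriorNormal_fst hΩ).prodMk continuousOn_const)

theorem sum_integral_sub_const_mul {α ι : Type*} [MeasurableSpace α] [Fintype ι] {μ : Measure α}
    {f g : ι → α → ℝ} (hf : ∀ i, Integrable (f i) μ) (hg : ∀ i, Integrable (g i) μ) (c : ℝ) :
    ∑ i, ((∫ x, f i x ∂μ) - c * ∫ x, g i x ∂μ) = ∫ x, ∑ i, (f i x - c * g i x) ∂μ := by
  have h : ∀ i, Integrable (fun x => f i x - c * g i x) μ := fun i =>
    (hf i).sub ((hg i).const_mul c)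
  rw [integral_finsetSum _ fun i _ => h i]
  refine Finset.sum_congr rfl fun i _ => ?_
  rw [integral_sub (hf i) ((hg i).const_mul c), integral_const_mul]

/-- The identity `Δv ∂_d v = div (∂_d v ∇v) - ½ ∂_d |∇v|²`, integrated. -/
theorem integral_laplacian_mul_cylDeriv (hΩ : IsBoundedC2Domain Ω) (hT : 0 < T)
    (hv : ContDiffOn ℝ 2 v (closedCylinder Ω T)) (d : EuclideanSpace ℝ (Fin n) × ℝ) :
    ∫ p in cylinder Ω T, cylLaplacian Ω T v p * cylDeriv Ω T v d p =
      ∑ i, ((∫ p in cylinder Ω T, cylDeriv Ω T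
          (fun p => cylDeriv Ω T v (EuclideanSpace.single i 1, 0) p * cylDeriv Ω T v d p)
          (EuclideanSpace.single i 1, 0) p)
        - 1 / 2 * ∫ p in cylinder Ω T, cylDeriv Ω T
          (fun p => cylDeriv Ω T v (EuclideanSpace.single i 1, 0) p *
            cylDeriv Ω T v (EuclideanSpace.single i 1, 0) p) d p) := by
  have h1 : ∀ d, ContDiffOn ℝ 1 (cylDeriv Ω T v d) (closedCylinder Ω T) := fun d =>
    contDiffOn_cylDeriv hΩ hT hv
  have hi : ∀ a b d, IntegrableOn (cylDeriv Ω T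
      (fun p => cylDeriv Ω T v a p * cylDeriv Ω T v b p) d) (cylinder Ω T) := fun a b d =>
    integrableOn_cylinder hΩ (continuousOn_cylDeriv hΩ hT ((h1 a).mul (h1 b)))
  rw [sum_integral_sub_const_mul (fun i => hi _ _ _) (fun i => hi _ _ _)]
  refine setIntegral_congr_fun (isOpen_cylinder hΩ).measurableSet fun p hp => ?_
  have hpK := cylinder_subset_closedCylinder hp
  simp only [cylLaplacian, Finset.sum_mul]
  refine Finset.sum_congr rfl fun i _ => ?_
  rw [cylDeriv_mul hΩ hT (h1 _) (h1 _) hpK, cylDeriv_mul hΩ hT (h1 _) (h1 _) hpK,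
    cylDeriv_comm hΩ hv hp (d := d) (d' := (EuclideanSpace.single i 1, 0))]
  ring

/-- Up to a lateral term that vanishes with `∂_t v`, twice the left-hand side is `- ε ∫ ∂_t |∇v|²`,
and `∇v` vanishes on the base `Ω_ε`. -/
theorem integral_laplacian_mul_time_nonpos (hσ : IsBoundaryMeasure Ω σ C)
    (hΩ : IsBoundedC2Domain Ω) (hT : 0 < T) (hv : ContDiffOn ℝ 2 v (closedCylinder Ω T))
    (hv0 : ∀ x ∈ frontier Ω, ∀ t ∈ Ioo 0 T, v (x, t) = 0)
    (hε : ε = 1 ∨ ε = -1) (hvb : ∀ x ∈ Ω, v (x, baseTime T ε) = 0) :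
    ε * ∫ p in cylinder Ω T, cylLaplacian Ω T v p * cylDeriv Ω T v (0, 1) p ≤ 0 := by
  have h1 : ∀ d, ContDiffOn ℝ 1 (cylDeriv Ω T v d) (closedCylinder Ω T) := fun d =>
    contDiffOn_cylDeriv hΩ hT hv
  have hd : ∀ p ∈ closedCylinder Ω T, DifferentiableWithinAt ℝ v (closedCylinder Ω T) p :=
    fun p hp => (hv p hp).differentiableWithinAt (by norm_num)
  rw [integral_laplacian_mul_cylDeriv hΩ hT hv, Finset.mul_sum]
  refine Finset.sum_nonpos fun i _ => ?_
  rw [hσ.integral_cylDeriv_space hΩ hT ((h1 _).mul (h1 _)),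
    integral_cylDeriv_time hΩ hT ((h1 _).mul (h1 _))]
  have hz : ∫ p, cylDeriv Ω T v (EuclideanSpace.single i 1, 0) p * cylDeriv Ω T v (0, 1) p *
      ⟪exteriorNormal Ω p.1, EuclideanSpace.single i 1⟫_ℝ ∂(lateralMeasure T σ) = 0 := by
    refine integral_eq_zero_of_ae ?_
    filter_upwards [hσ.ae_lateralMeasure (T := T)] with p hp
    rw [cylDeriv_lateral_time (hd p (frontier_prod_subset ⟨hp.1, Ioo_subset_Icc_self hp.2⟩)) hp hv0]
    simp
  rw [hz]
  have hbase : ∀ x ∈ Ω, ∀ t ∈ Icc 0 T, (∀ y ∈ Ω, v (y, t) = 0) →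
      cylDeriv Ω T v (EuclideanSpace.single i 1, 0) (x, t) = 0 := fun x hx t ht h0 =>
    cylDeriv_eq_zero_of_slice_eq_zero hΩ (hd _ ⟨subset_closure hx, ht⟩) ⟨hx, ht⟩ h0 _
  have hpos : 0 ≤ ε * ∫ x in Ω, (cylDeriv Ω T v (EuclideanSpace.single i 1, 0) (x, T) *
      cylDeriv Ω T v (EuclideanSpace.single i 1, 0) (x, T) -
      cylDeriv Ω T v (EuclideanSpace.single i 1, 0) (x, 0) *
      cylDeriv Ω T v (EuclideanSpace.single i 1, 0) (x, 0)) := by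
    rw [← integral_const_mul]
    refine setIntegral_nonneg hΩ.isOpen.measurableSet fun x hx => ?_
    rcases hε with rfl | rfl
    · rw [hbase x hx 0 (left_mem_Icc.2 hT.le) fun y hy => by simpa [baseTime] using hvb y hy]
      nlinarith [mul_self_nonneg (cylDeriv Ω T v (EuclideanSpace.single i 1, 0) (x, T))]
    · rw [hbase x hx T (right_mem_Icc.2 hT.le) fun y hy => by
        simpa [baseTime, show ¬ (0 : ℝ) < -1 by norm_num] using hvb y hy]
      nlinarith [mul_self_nonneg (cylDeriv Ω T v (EuclideanSpace.single i 1, 0) (x, 0))]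
  linarith

theorem sum_inner_single_sq (x : EuclideanSpace ℝ (Fin n)) :
    ∑ i, ⟪x, EuclideanSpace.single i (1 : ℝ)⟫_ℝ ^ 2 = ‖x‖ ^ 2 := by
  simp [EuclideanSpace.norm_sq_eq, EuclideanSpace.inner_single_right]

/-- The Rellich identity: both boundary terms are computed from `∇v = (∂_ν v) ν` on the lateral
boundary. -/
theorem integral_laplacian_mul_space (hσ : IsBoundaryMeasure Ω σ C)
    (hΩ : IsBoundedC2Domain Ω) (hT : 0 < T) (hv : ContDiffOn ℝ 2 v (closedCylinder Ω T))
    (hv0 : ∀ x ∈ frontier Ω, ∀ t ∈ Ioo 0 T, v (x, t) = 0) (ω : EuclideanSpace ℝ (Fin n)) :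
    2 * ∫ p in cylinder Ω T, cylLaplacian Ω T v p * cylDeriv Ω T v (ω, 0) p =
      ∫ p, lateralNormalDeriv Ω T v p ^ 2 * ⟪exteriorNormal Ω p.1, ω⟫_ℝ ∂(lateralMeasure T σ) := by
  have h1 : ∀ d, ContDiffOn ℝ 1 (cylDeriv Ω T v d) (closedCylinder Ω T) := fun d =>
    contDiffOn_cylDeriv hΩ hT hv
  have hi : ∀ a b (w : EuclideanSpace ℝ (Fin n)), Integrable (fun p => cylDeriv Ω T v a p *
      cylDeriv Ω T v b p * ⟪exteriorNormal Ω p.1, w⟫_ℝ) (lateralMeasure T σ) := fun a b w =>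
    hσ.integrable_lateralMeasure hΩ ((((h1 a).mul (h1 b)).continuousOn.mono
      frontier_prod_subset).mul ((continuousOn_exteriorNormal_fst hΩ).inner continuousOn_const))
  rw [integral_laplacian_mul_cylDeriv hΩ hT hv]
  simp_rw [fun i => hσ.integral_cylDeriv_space hΩ hT ((h1 (EuclideanSpace.single i 1, 0)).mul
    (h1 (ω, 0))) (EuclideanSpace.single i 1),
    fun i => hσ.integral_cylDeriv_space hΩ hT ((h1 (EuclideanSpace.single i 1, 0)).mul
    (h1 (EuclideanSpace.single i 1, 0))) ω]
  rw [sum_integral_sub_const_mul (fun i => hi _ _ _) (fun i => hi _ _ _), ← integral_const_mul]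
  refine integral_congr_ae ?_
  filter_upwards [hσ.ae_lateralMeasure (T := T)] with p hp
  have hd : DifferentiableWithinAt ℝ v (closedCylinder Ω T) p :=
    (hv p (frontier_prod_subset ⟨hp.1, Ioo_subset_Icc_self hp.2⟩)).differentiableWithinAt
      (by norm_num)
  have hs := sum_inner_single_sq (exteriorNormal Ω p.1)
  rw [(hΩ.isExteriorUnitNormal hp.1).1] at hs
  obtain ⟨N, hN⟩ : ∃ N, lateralNormalDeriv Ω T v p = N := ⟨_, rfl⟩
  have hgrad : ∀ w, cylDeriv Ω T v (w, 0) p = N * ⟪exteriorNormal Ω p.1, w⟫_ℝ := fun w => by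
    rw [← hN]; exact cylDeriv_lateral_space hΩ hd hp hv0 w
  simp only [hgrad, hN]
  have : ∀ a : ℝ, N * a * (N * ⟪exteriorNormal Ω p.1, ω⟫_ℝ) * a -
      1 / 2 * (N * a * (N * a) * ⟪exteriorNormal Ω p.1, ω⟫_ℝ) =
      1 / 2 * (N ^ 2 * ⟪exteriorNormal Ω p.1, ω⟫_ℝ) * a ^ 2 := fun a => by ring
  simp_rw [this]
  rw [← Finset.mul_sum, hs]
  ring

theorem cylDeriv_transport (ρ : ℝ) (p : EuclideanSpace ℝ (Fin n) × ℝ) :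
    cylDeriv Ω T v (-(2 * ρ) • ω, 1) p =
      cylDeriv Ω T v (0, 1) p - 2 * ρ * cylDeriv Ω T v (ω, 0) p := by
  have : ((-(2 * ρ) • ω, 1) : EuclideanSpace ℝ (Fin n) × ℝ) =
      (0, 1) + (-(2 * ρ)) • (ω, 0) := by simp
  rw [this, cylDeriv_add_dir, cylDeriv_smul_dir]
  ring

/-- The square of `ε D - Δ`, where `D = ∂_t - 2 ρ ω · ∇`, is bounded below through its cross term,
whose interior part has a sign. -/
theorem integral_transport_sq_add_lateral_le (hσ : IsBoundaryMeasure Ω σ C)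
    (hΩ : IsBoundedC2Domain Ω) (hT : 0 < T) (hv : ContDiffOn ℝ 2 v (closedCylinder Ω T))
    (hv0 : ∀ x ∈ frontier Ω, ∀ t ∈ Ioo 0 T, v (x, t) = 0)
    (hε : ε = 1 ∨ ε = -1) (hvb : ∀ x ∈ Ω, v (x, baseTime T ε) = 0) :
    (∫ p in cylinder Ω T, cylDeriv Ω T v (-(2 * ρ) • ω, 1) p ^ 2) + 2 * ρ * (ε *
      ∫ p, lateralNormalDeriv Ω T v p ^ 2 * ⟪exteriorNormal Ω p.1, ω⟫_ℝ ∂(lateralMeasure T σ)) ≤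
      ∫ p in cylinder Ω T, conjugatedOp Ω T ε ω ρ v p ^ 2 := by
  have hc : ∀ d, ContinuousOn (cylDeriv Ω T v d) (closedCylinder Ω T) := fun d =>
    continuousOn_cylDeriv hΩ hT (hv.of_le (by norm_num))
  have hl := continuousOn_cylLaplacian hΩ hT hv
  have hi1 : IntegrableOn (fun p => cylDeriv Ω T v (-(2 * ρ) • ω, 1) p ^ 2) (cylinder Ω T) :=
    integrableOn_cylinder hΩ ((hc _).pow 2)
  have hi2 : ∀ d, IntegrableOn (fun p => cylLaplacian Ω T v p * cylDeriv Ω T v d p)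
    (cylinder Ω T) := fun d => integrableOn_cylinder hΩ (hl.mul (hc d))
  have hi3 : IntegrableOn (fun p => 2 * ε * (cylLaplacian Ω T v p * cylDeriv Ω T v (0, 1) p) -
      4 * ε * ρ * (cylLaplacian Ω T v p * cylDeriv Ω T v (ω, 0) p)) (cylinder Ω T) :=
    ((hi2 _).const_mul _).sub ((hi2 _).const_mul _)
  have htime := integral_laplacian_mul_time_nonpos hσ hΩ hT hv hv0 hε hvb
  have hspace := integral_laplacian_mul_space hσ hΩ hT hv hv0 ω
  have hle : ∫ p in cylinder Ω T, (cylDeriv Ω T v (-(2 * ρ) • ω, 1) p ^ 2 -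
      (2 * ε * (cylLaplacian Ω T v p * cylDeriv Ω T v (0, 1) p) -
        4 * ε * ρ * (cylLaplacian Ω T v p * cylDeriv Ω T v (ω, 0) p))) ≤
      ∫ p in cylinder Ω T, conjugatedOp Ω T ε ω ρ v p ^ 2 := by
    refine setIntegral_mono (hi1.sub hi3)
      (integrableOn_cylinder hΩ ((continuousOn_conjugatedOp hΩ hT hv).pow 2)) fun p => ?_
    have hε2 : ε ^ 2 = 1 := by rcases hε with rfl | rfl <;> norm_num
    dsimp only
    rw [conjugatedOp, cylDeriv_transport]
    have : ∀ a l : ℝ, (ε * a - l) ^ 2 = a ^ 2 - 2 * ε * a * l + l ^ 2 := fun a l => by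
      linear_combination a ^ 2 * hε2
    rw [this]
    nlinarith [sq_nonneg (cylLaplacian Ω T v p)]
  rw [integral_sub hi1 hi3,
    integral_sub ((hi2 _).const_mul _) ((hi2 _).const_mul _), integral_const_mul,
    integral_const_mul] at hle
  rw [← hspace]
  linarith

/-- A Poincaré inequality along `D = ∂_t - 2 ρ ω · ∇`, from integrating `D (v² g)` for the weight
`g = ω · x + 2 ε R`, for which `D g = - 2 ρ`. -/
theorem integral_sq_le_integral_transport_sq (hσ : IsBoundaryMeasure Ω σ C)
    (hΩ : IsBoundedC2Domain Ω) (hT : 0 < T) {R : ℝ} (hR : 0 < R) (hΩR : ∀ x ∈ closure Ω, ‖x‖ ≤ R)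
    (hv : ContDiffOn ℝ 1 v (closedCylinder Ω T))
    (hv0 : ∀ x ∈ frontier Ω, ∀ t ∈ Ioo 0 T, v (x, t) = 0)
    (hε : ε = 1 ∨ ε = -1) (hvb : ∀ x ∈ Ω, v (x, baseTime T ε) = 0) (hω : ‖ω‖ = 1) (hρ : 0 < ρ) :
    R * (∫ x in Ω, v (x, baseTime T (-ε)) ^ 2) + ρ * (∫ p in cylinder Ω T, v p ^ 2) ≤
      9 * R ^ 2 / ρ * ∫ p in cylinder Ω T, cylDeriv Ω T v (-(2 * ρ) • ω, 1) p ^ 2 := by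
  set g : EuclideanSpace ℝ (Fin n) × ℝ → ℝ := fun p => ⟪ω, p.1⟫_ℝ + 2 * ε * R with hg
  have hgc : ContDiff ℝ 1 g := by
    rw [hg]
    exact (contDiff_const.inner ℝ contDiff_fst).add contDiff_const
  have hinner : ∀ x ∈ closure Ω, |⟪ω, x⟫_ℝ| ≤ R := fun x hx => by
    have := abs_real_inner_le_norm ω x
    rw [hω, one_mul] at this
    exact this.trans (hΩR x hx)
  have hg1 : ∀ p ∈ closedCylinder Ω T, R ≤ ε * g p ∧ ε * g p ≤ 3 * R := fun p hp => by
    have := abs_le.1 (hinner p.1 hp.1)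
    rcases hε with rfl | rfl <;> simp only [hg] <;> constructor <;> linarith
  have hε2 : ε * ε = 1 := by rcases hε with rfl | rfl <;> norm_num
  have hg2 : ∀ p ∈ closedCylinder Ω T, g p ^ 2 ≤ 9 * R ^ 2 := fun p hp => by
    have h := hg1 p hp
    have h2 : g p ^ 2 = (ε * g p) ^ 2 := by linear_combination (-(g p ^ 2)) * hε2
    rw [h2]
    nlinarith
  set D : EuclideanSpace ℝ (Fin n) × ℝ := (-(2 * ρ) • ω, 1) with hD
  have hgD : ∀ p ∈ closedCylinder Ω T, cylDeriv Ω T g D p = -(2 * ρ) := fun p hp => by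
    have h1 : HasFDerivAt g ((innerSL ℝ ω).comp (ContinuousLinearMap.fst ℝ _ ℝ)) p :=
      ((innerSL ℝ ω).hasFDerivAt.comp p hasFDerivAt_fst).add_const _
    rw [cylDeriv, h1.hasFDerivWithinAt.fderivWithin (uniqueDiffOn_closedCylinder hΩ hT p hp)]
    simp [hD, inner_smul_right, hω]
  set F : EuclideanSpace ℝ (Fin n) × ℝ → ℝ := fun p => v p * v p * g p with hF
  have hFc : ContDiffOn ℝ 1 F (closedCylinder Ω T) := (hv.mul hv).mul hgc.contDiffOn
  have hvD := continuousOn_cylDeriv (d := D) hΩ hT hv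
  have hiv : IntegrableOn (fun p => v p ^ 2) (cylinder Ω T) :=
    integrableOn_cylinder hΩ (hv.continuousOn.pow 2)
  have hiD : IntegrableOn (fun p => cylDeriv Ω T v D p ^ 2) (cylinder Ω T) :=
    integrableOn_cylinder hΩ (hvD.pow 2)
  have hFD : ∀ p ∈ closedCylinder Ω T,
      cylDeriv Ω T F D p ≤ 9 * R ^ 2 / ρ * cylDeriv Ω T v D p ^ 2 - ρ * v p ^ 2 := fun p hp => by
    rw [hF, cylDeriv_mul hΩ hT (hv.mul hv) hgc.contDiffOn hp, cylDeriv_mul hΩ hT hv hv hp,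
      hgD p hp]
    -- Young's inequality, as a sum of squares
    have h1 : 9 * R ^ 2 / ρ * cylDeriv Ω T v D p ^ 2 - ρ * v p ^ 2 -
        (v p * v p * -(2 * ρ) + (v p * cylDeriv Ω T v D p + cylDeriv Ω T v D p * v p) * g p) =
        ((9 * R ^ 2 - g p ^ 2) * cylDeriv Ω T v D p ^ 2 +
          (ρ * v p - g p * cylDeriv Ω T v D p) ^ 2) / ρ := by
      field_simp
      ring
    have h2 : 0 ≤ ((9 * R ^ 2 - g p ^ 2) * cylDeriv Ω T v D p ^ 2 +
          (ρ * v p - g p * cylDeriv Ω T v D p) ^ 2) / ρ :=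
      div_nonneg (add_nonneg (mul_nonneg (sub_nonneg.2 (hg2 p hp)) (sq_nonneg _)) (sq_nonneg _))
        hρ.le
    linarith
  have hup : ∫ p in cylinder Ω T, cylDeriv Ω T F D p ≤
      9 * R ^ 2 / ρ * (∫ p in cylinder Ω T, cylDeriv Ω T v D p ^ 2) -
        ρ * ∫ p in cylinder Ω T, v p ^ 2 := by
    rw [← integral_const_mul, ← integral_const_mul,
      ← integral_sub (hiD.const_mul _) (hiv.const_mul _)]
    exact setIntegral_mono_on (integrableOn_cylinder hΩ (continuousOn_cylDeriv hΩ hT hFc))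
      ((hiD.const_mul _).sub (hiv.const_mul _)) (isOpen_cylinder hΩ).measurableSet
      fun p hp => hFD p (cylinder_subset_closedCylinder hp)
  have hbase : R * (∫ x in Ω, v (x, baseTime T (-ε)) ^ 2) ≤
      ∫ x in Ω, (F (x, T) - F (x, 0)) := by
    rw [← integral_const_mul]
    have hbt : ∀ ε, baseTime T ε ∈ Icc 0 T := fun ε => by
      unfold baseTime
      split_ifs
      exacts [left_mem_Icc.2 hT.le, right_mem_Icc.2 hT.le]
    refine setIntegral_mono_on ((integrableOn_slice hΩ (f := fun p => v p ^ 2)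
      (hv.continuousOn.pow 2) (hbt _)).const_mul _)
      ((integrableOn_slice hΩ hFc.continuousOn (right_mem_Icc.2 hT.le)).sub
        (integrableOn_slice hΩ hFc.continuousOn (left_mem_Icc.2 hT.le)))
      hΩ.isOpen.measurableSet fun x hx => ?_
    have hvx := hvb x hx
    rcases hε with rfl | rfl
    · have h1 := (hg1 (x, T) ⟨subset_closure hx, right_mem_Icc.2 hT.le⟩).1
      have e1 : baseTime T 1 = 0 := by simp [baseTime]
      have e2 : baseTime T (-1) = T := by simp [baseTime, show ¬ (0 : ℝ) < -1 by norm_num]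
      rw [e1] at hvx
      rw [e2]
      simp only [hF, hvx]
      nlinarith [sq_nonneg (v (x, T))]
    · have h1 := (hg1 (x, 0) ⟨subset_closure hx, left_mem_Icc.2 hT.le⟩).1
      have e1 : baseTime T (- -1) = 0 := by simp [baseTime]
      have e2 : baseTime T (-1) = T := by simp [baseTime, show ¬ (0 : ℝ) < -1 by norm_num]
      rw [e2] at hvx
      rw [e1]
      simp only [hF, hvx]
      nlinarith [sq_nonneg (v (x, 0))]
  have hdiv : ∫ p in cylinder Ω T, cylDeriv Ω T F D p = ∫ x in Ω, (F (x, T) - F (x, 0)) := by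
    have hFi : ∀ d, IntegrableOn (cylDeriv Ω T F d) (cylinder Ω T) := fun d =>
      integrableOn_cylinder hΩ (continuousOn_cylDeriv hΩ hT hFc)
    have hz : ∫ p in cylinder Ω T, cylDeriv Ω T F (ω, 0) p = 0 := by
      rw [hσ.integral_cylDeriv_space hΩ hT hFc]
      refine integral_eq_zero_of_ae ?_
      filter_upwards [hσ.ae_lateralMeasure (T := T)] with p hp
      have : v p = 0 := hv0 p.1 hp.1 p.2 hp.2
      simp [hF, this]
    rw [← integral_cylDeriv_time hΩ hT hFc, hD]
    simp_rw [cylDeriv_transport]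
    rw [integral_sub (hFi _) ((hFi _).const_mul _), integral_const_mul, hz]
    ring
  rw [hdiv] at hup
  linarith

/-- The estimate for a real-valued function and the conjugated operator. The lateral integrals are
those of `(∂_ν v)² (ν · ω)⁺` and `(∂_ν v)² (ν · ω)⁻` for `ε = 1`, the other way around for
`ε = -1`. -/
theorem conjugated_estimate (hσ : IsBoundaryMeasure Ω σ C)
    (hΩ : IsBoundedC2Domain Ω) (hT : 0 < T) {R : ℝ} (hR : 0 < R) (hΩR : ∀ x ∈ closure Ω, ‖x‖ ≤ R)
    (hv : ContDiffOn ℝ 2 v (closedCylinder Ω T))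
    (hv0 : ∀ x ∈ frontier Ω, ∀ t ∈ Ioo 0 T, v (x, t) = 0)
    (hε : ε = 1 ∨ ε = -1) (hvb : ∀ x ∈ Ω, v (x, baseTime T ε) = 0) (hω : ‖ω‖ = 1) (hρ : 1 ≤ ρ) :
    (∫ x in Ω, v (x, baseTime T (-ε)) ^ 2)
      + ρ * (∫ p, lateralNormalDeriv Ω T v p ^ 2 * max (ε * ⟪exteriorNormal Ω p.1, ω⟫_ℝ) 0
          ∂(lateralMeasure T σ))
      + ρ ^ 2 * (∫ p in cylinder Ω T, v p ^ 2) ≤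
      2 * (9 * R + 9 * R ^ 2 + 1) * ((∫ p in cylinder Ω T, conjugatedOp Ω T ε ω ρ v p ^ 2)
        + ρ * (∫ p, lateralNormalDeriv Ω T v p ^ 2 * max (-ε * ⟪exteriorNormal Ω p.1, ω⟫_ℝ) 0
          ∂(lateralMeasure T σ))) := by
  have hρ0 : 0 < ρ := by linarith
  have h1 := integral_transport_sq_add_lateral_le (ρ := ρ) (ω := ω) hσ hΩ hT hv hv0 hε hvb
  have h2 := integral_sq_le_integral_transport_sq hσ hΩ hT hR hΩR (hv.of_le (by norm_num)) hv0 hε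
    hvb hω hρ0
  have hi : ∀ s : ℝ, Integrable (fun p => lateralNormalDeriv Ω T v p ^ 2 *
      max (s * ⟪exteriorNormal Ω p.1, ω⟫_ℝ) 0) (lateralMeasure T σ) := fun s =>
    hσ.integrable_lateralMeasure hΩ
      (((continuousOn_lateralNormalDeriv hΩ hT (hv.of_le (by norm_num))).pow 2).mul
        ((continuousOn_const.mul ((continuousOn_exteriorNormal_fst hΩ).inner
          continuousOn_const)).sup continuousOn_const))
  have hnn : ∀ s : ℝ, 0 ≤ ∫ p, lateralNormalDeriv Ω T v p ^ 2 *
      max (s * ⟪exteriorNormal Ω p.1, ω⟫_ℝ) 0 ∂(lateralMeasure T σ) := fun s =>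
    integral_nonneg fun p => mul_nonneg (sq_nonneg _) (le_max_right _ _)
  have hsplit : ε * ∫ p, lateralNormalDeriv Ω T v p ^ 2 * ⟪exteriorNormal Ω p.1, ω⟫_ℝ
      ∂(lateralMeasure T σ) =
      (∫ p, lateralNormalDeriv Ω T v p ^ 2 * max (ε * ⟪exteriorNormal Ω p.1, ω⟫_ℝ) 0
        ∂(lateralMeasure T σ)) -
      ∫ p, lateralNormalDeriv Ω T v p ^ 2 * max (-ε * ⟪exteriorNormal Ω p.1, ω⟫_ℝ) 0
        ∂(lateralMeasure T σ) := by
    rw [← integral_const_mul, ← integral_sub (hi ε) (hi (-ε))]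
    congr 1
    funext p
    have hmax : ∀ a : ℝ, a = max a 0 - max (-a) 0 := fun a => by
      rcases le_total 0 a with h | h
      · rw [max_eq_left h, max_eq_right (by linarith)]; ring
      · rw [max_eq_right h, max_eq_left (by linarith)]; ring
    have := hmax (ε * ⟪exteriorNormal Ω p.1, ω⟫_ℝ)
    rw [← mul_sub, neg_mul, ← this]
    ring
  rw [hsplit] at h1
  have hSe := hnn ε
  have hSe' := hnn (-ε)
  set X := ∫ p in cylinder Ω T, cylDeriv Ω T v (-(2 * ρ) • ω, 1) p ^ 2
  set A := ∫ x in Ω, v (x, baseTime T (-ε)) ^ 2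
  set B := ∫ p in cylinder Ω T, v p ^ 2
  set Y := ∫ p in cylinder Ω T, conjugatedOp Ω T ε ω ρ v p ^ 2
  set S := ∫ p, lateralNormalDeriv Ω T v p ^ 2 * max (ε * ⟪exteriorNormal Ω p.1, ω⟫_ℝ) 0
        ∂(lateralMeasure T σ)
  set S' := ∫ p, lateralNormalDeriv Ω T v p ^ 2 * max (-ε * ⟪exteriorNormal Ω p.1, ω⟫_ℝ) 0
        ∂(lateralMeasure T σ)
  have hX0 : 0 ≤ X := integral_nonneg fun p => sq_nonneg _
  have hA0 : 0 ≤ A := integral_nonneg fun p => sq_nonneg _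
  have hB0 : 0 ≤ B := integral_nonneg fun p => sq_nonneg _
  have hY0 : 0 ≤ Y := integral_nonneg fun p => sq_nonneg _
  have hA : A ≤ 9 * R * X := by
    have h3 : R * A ≤ 9 * R ^ 2 / ρ * X := by nlinarith
    have h4 : 9 * R ^ 2 / ρ * X ≤ 9 * R ^ 2 * X :=
      mul_le_mul_of_nonneg_right (div_le_self (by positivity) hρ) hX0
    have h5 : R * A ≤ R * (9 * R * X) := by linarith
    exact le_of_mul_le_mul_left h5 hR
  have hB : ρ ^ 2 * B ≤ 9 * R ^ 2 * X := by
    have h3 : ρ * B ≤ 9 * R ^ 2 / ρ * X := by nlinarith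
    have h4 : ρ * (ρ * B) ≤ ρ * (9 * R ^ 2 / ρ * X) := mul_le_mul_of_nonneg_left h3 hρ0.le
    have h5 : ρ * (9 * R ^ 2 / ρ * X) = 9 * R ^ 2 * X := by field_simp
    linarith
  have hρS : 0 ≤ ρ * S := mul_nonneg hρ0.le hSe
  have hρS' : 0 ≤ ρ * S' := mul_nonneg hρ0.le hSe'
  set c := 9 * R + 9 * R ^ 2 with hc
  have hc0 : 0 ≤ c := by positivity
  have hcS : 0 ≤ c * (ρ * S) := mul_nonneg hc0 hρS
  have hXS : X + 2 * (ρ * S) ≤ Y + 2 * (ρ * S') := by linarith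
  have hfin : (c + 1) * (X + 2 * (ρ * S)) ≤ (c + 1) * (Y + 2 * (ρ * S')) :=
    mul_le_mul_of_nonneg_left hXS (by linarith)
  have hcY : 0 ≤ (c + 1) * Y := mul_nonneg (by linarith) hY0
  have : A + ρ ^ 2 * B ≤ c * X := by rw [hc]; linarith
  nlinarith

end ConjugatedOperator

/-! ### Conjugation with the weight -/

section Conjugation

variable {n : ℕ} {Ω : Set (EuclideanSpace ℝ (Fin n))} {T : ℝ}

/-- The square root `exp (-ε (ρ ω · x + ρ² t))` of the weight. -/
def halfWeight (ε : ℝ) (ω : EuclideanSpace ℝ (Fin n)) (ρ : ℝ)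
    (p : EuclideanSpace ℝ (Fin n) × ℝ) : ℝ :=
  Real.exp (-(ε * (ρ * ⟪ω, p.1⟫_ℝ + ρ ^ 2 * p.2)))

variable {ε ρ : ℝ} {ω : EuclideanSpace ℝ (Fin n)} {p d : EuclideanSpace ℝ (Fin n) × ℝ}
  {r : EuclideanSpace ℝ (Fin n) × ℝ → ℝ} {u : EuclideanSpace ℝ (Fin n) × ℝ → ℂ}

theorem halfWeight_sq : halfWeight ε ω ρ p ^ 2 = weight ε ω ρ p := by
  rw [halfWeight, weight, ← Real.exp_nat_mul]
  congr 1
  push_cast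
  ring

theorem contDiff_halfWeight {m : WithTop ℕ∞} : ContDiff ℝ m (halfWeight (n := n) ε ω ρ) := by
  unfold halfWeight
  exact ((contDiff_const.mul ((contDiff_const.mul (contDiff_const.inner ℝ contDiff_fst)).add
    (contDiff_const.mul contDiff_snd))).neg).exp

theorem cylDeriv_halfWeight (hΩ : IsBoundedC2Domain Ω) (hT : 0 < T)
    (hp : p ∈ closedCylinder Ω T) :
    cylDeriv Ω T (halfWeight ε ω ρ) d p =
      -(ε * (ρ * ⟪ω, d.1⟫_ℝ + ρ ^ 2 * d.2)) * halfWeight ε ω ρ p := by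
  have h1 : HasFDerivAt (fun p : EuclideanSpace ℝ (Fin n) × ℝ => ⟪ω, p.1⟫_ℝ)
      ((innerSL ℝ ω).comp (ContinuousLinearMap.fst ℝ _ ℝ)) p :=
    (innerSL ℝ ω).hasFDerivAt.comp p hasFDerivAt_fst
  have h2 := ((((h1.const_mul ρ).add ((hasFDerivAt_snd (𝕜 := ℝ) (p := p)).const_mul
    (ρ ^ 2))).const_mul ε).neg).exp
  have h3 : HasFDerivAt (halfWeight ε ω ρ) _ p := h2
  rw [cylDeriv, h3.hasFDerivWithinAt.fderivWithin (uniqueDiffOn_closedCylinder hΩ hT p hp)]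
  simp [halfWeight]
  ring

theorem cylDeriv_congr {f g : EuclideanSpace ℝ (Fin n) × ℝ → ℝ}
    (h : ∀ p ∈ closedCylinder Ω T, f p = g p) (hp : p ∈ closedCylinder Ω T) :
    cylDeriv Ω T f d p = cylDeriv Ω T g d p := by
  rw [cylDeriv, fderivWithin_congr h (h p hp), cylDeriv]

theorem cylDeriv_halfWeight_mul (hΩ : IsBoundedC2Domain Ω) (hT : 0 < T)
    (hr : ContDiffOn ℝ 1 r (closedCylinder Ω T)) (hp : p ∈ closedCylinder Ω T) :
    cylDeriv Ω T (fun p => halfWeight ε ω ρ p * r p) d p =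
      halfWeight ε ω ρ p * (cylDeriv Ω T r d p - ε * (ρ * ⟪ω, d.1⟫_ℝ + ρ ^ 2 * d.2) * r p) := by
  rw [cylDeriv_mul hΩ hT contDiff_halfWeight.contDiffOn hr hp, cylDeriv_halfWeight hΩ hT hp]
  ring

theorem cylDeriv_sub_const_mul (hΩ : IsBoundedC2Domain Ω) (hT : 0 < T)
    {f g : EuclideanSpace ℝ (Fin n) × ℝ → ℝ} (hf : ContDiffOn ℝ 1 f (closedCylinder Ω T))
    (hg : ContDiffOn ℝ 1 g (closedCylinder Ω T)) (c : ℝ) (hp : p ∈ closedCylinder Ω T) :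
    cylDeriv Ω T (fun p => f p - c * g p) d p = cylDeriv Ω T f d p - c * cylDeriv Ω T g d p := by
  have h1 := ((hf p hp).differentiableWithinAt (by norm_num)).hasFDerivWithinAt
  have h2 := ((hg p hp).differentiableWithinAt (by norm_num)).hasFDerivWithinAt
  have h3 : HasFDerivWithinAt (fun p => f p - c * g p) _ (closedCylinder Ω T) p :=
    h1.sub (h2.const_mul c)
  rw [cylDeriv, h3.fderivWithin (uniqueDiffOn_closedCylinder hΩ hT p hp)]
  simp [cylDeriv]

theorem sum_inner_single_mul_cylDeriv :
    ∑ i, ⟪ω, EuclideanSpace.single i (1 : ℝ)⟫_ℝ * cylDeriv Ω T r (EuclideanSpace.single i 1, 0) p =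
      cylDeriv Ω T r (ω, 0) p := by
  have h : ((ω, 0) : EuclideanSpace ℝ (Fin n) × ℝ) =
      ∑ i, ⟪ω, EuclideanSpace.single i (1 : ℝ)⟫_ℝ • (EuclideanSpace.single i (1 : ℝ), (0 : ℝ)) := by
    refine Prod.ext ?_ ?_
    · rw [Prod.fst_sum]
      ext j
      simp [EuclideanSpace.inner_single_right, Pi.single_apply]
    · rw [Prod.snd_sum]
      simp
  rw [h, cylDeriv, map_sum]
  exact Finset.sum_congr rfl fun i _ => (cylDeriv_smul_dir _).symm

theorem cylLaplacian_halfWeight_mul (hΩ : IsBoundedC2Domain Ω) (hT : 0 < T)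
    (hr : ContDiffOn ℝ 2 r (closedCylinder Ω T)) (hp : p ∈ closedCylinder Ω T)
    (hε : ε * ε = 1) (hω : ‖ω‖ = 1) :
    cylLaplacian Ω T (fun p => halfWeight ε ω ρ p * r p) p =
      halfWeight ε ω ρ p *
        (cylLaplacian Ω T r p - 2 * ε * ρ * cylDeriv Ω T r (ω, 0) p + ρ ^ 2 * r p) := by
  have hr1 : ContDiffOn ℝ 1 r (closedCylinder Ω T) := hr.of_le (by norm_num)
  have h : ∀ i, cylDeriv Ω T (cylDeriv Ω T (fun p => halfWeight ε ω ρ p * r p)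
      (EuclideanSpace.single i 1, 0)) (EuclideanSpace.single i 1, 0) p =
      halfWeight ε ω ρ p * (cylDeriv Ω T (cylDeriv Ω T r (EuclideanSpace.single i 1, 0))
        (EuclideanSpace.single i 1, 0) p -
        2 * ε * ρ * (⟪ω, EuclideanSpace.single i (1 : ℝ)⟫_ℝ *
          cylDeriv Ω T r (EuclideanSpace.single i 1, 0) p) +
        ρ ^ 2 * r p * ⟪ω, EuclideanSpace.single i (1 : ℝ)⟫_ℝ ^ 2) := fun i => by
    have hd := contDiffOn_cylDeriv (d := (EuclideanSpace.single i 1, 0)) hΩ hT hr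
    rw [cylDeriv_congr (fun z hz => cylDeriv_halfWeight_mul hΩ hT hr1 hz) hp,
      cylDeriv_halfWeight_mul hΩ hT (hd.sub (contDiffOn_const.mul hr1)) hp,
      cylDeriv_sub_const_mul hΩ hT hd hr1 _ hp]
    linear_combination halfWeight ε ω ρ p * ρ ^ 2 * r p *
      ⟪ω, EuclideanSpace.single i (1 : ℝ)⟫_ℝ ^ 2 * hε
  have hs := sum_inner_single_sq ω
  rw [hω] at hs
  rw [cylLaplacian, Finset.sum_congr rfl fun i _ => h i, ← Finset.mul_sum, Finset.sum_add_distrib,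
    Finset.sum_sub_distrib, ← Finset.mul_sum, ← Finset.mul_sum, sum_inner_single_mul_cylDeriv, hs,
    cylLaplacian]
  ring

theorem conjugatedOp_halfWeight_mul (hΩ : IsBoundedC2Domain Ω) (hT : 0 < T)
    (hr : ContDiffOn ℝ 2 r (closedCylinder Ω T)) (hp : p ∈ closedCylinder Ω T)
    (hε : ε * ε = 1) (hω : ‖ω‖ = 1) :
    conjugatedOp Ω T ε ω ρ (fun p => halfWeight ε ω ρ p * r p) p =
      halfWeight ε ω ρ p * (ε * cylDeriv Ω T r (0, 1) p - cylLaplacian Ω T r p) := by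
  rw [conjugatedOp, cylLaplacian_halfWeight_mul hΩ hT hr hp hε hω,
    cylDeriv_halfWeight_mul hΩ hT (hr.of_le (by norm_num)) hp, cylDeriv_transport]
  simp only [inner_smul_right, real_inner_self_eq_norm_sq, hω]
  linear_combination halfWeight ε ω ρ p * ρ ^ 2 * r p * hε

theorem cylLaplacian_eq_laplacian (hΩ : IsBoundedC2Domain Ω) (hT : 0 < T)
    (hr : ContDiffOn ℝ 2 r (closedCylinder Ω T)) (hp : p ∈ cylinder Ω T) :
    cylLaplacian Ω T r p = Δ (fun y => r (y, p.2)) p.1 := by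
  obtain ⟨x, t⟩ := p
  have hx : x ∈ Ω := hp.1
  have ht : t ∈ Icc 0 T := Ioo_subset_Icc_self hp.2
  have hK : ∀ y ∈ Ω, (y, t) ∈ closedCylinder Ω T := fun y hy => ⟨subset_closure hy, ht⟩
  have hg : ContDiffAt ℝ 2 (fun y => r (y, t)) x :=
    (contDiffOn_slice hr ht).contDiffAt (closure_mem_nhds_of_isOpen hΩ.isOpen hx)
  have hdiff : DifferentiableAt ℝ (fderiv ℝ fun y => r (y, t)) x :=
    (hg.fderiv_right (m := 1) (by norm_num)).differentiableAt (by norm_num)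
  rw [InnerProductSpace.laplacian_eq_iteratedFDeriv_orthonormalBasis _
    (EuclideanSpace.basisFun (Fin n) ℝ)]
  refine Finset.sum_congr rfl fun i _ => ?_
  rw [iteratedFDeriv_two_apply]
  have h1 : ∀ (f : EuclideanSpace ℝ (Fin n) × ℝ → ℝ) (w : EuclideanSpace ℝ (Fin n)), ∀ y ∈ Ω,
      ContDiffOn ℝ 1 f (closedCylinder Ω T) →
      cylDeriv Ω T f (w, 0) (y, t) = fderiv ℝ (fun y => f (y, t)) y w := fun f w y hy hf => by
    rw [cylDeriv_eq_fderivWithin_slice hΩ ((hf _ (hK y hy)).differentiableWithinAt (by norm_num))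
      (hK y hy), fderivWithin_of_mem_nhds (closure_mem_nhds_of_isOpen hΩ.isOpen hy)]
  rw [h1 _ _ x hx (contDiffOn_cylDeriv hΩ hT hr)]
  have hev : (fun y => cylDeriv Ω T r (EuclideanSpace.single i 1, 0) (y, t)) =ᶠ[𝓝 x]
      fun y => fderiv ℝ (fun y => r (y, t)) y (EuclideanSpace.single i 1) := by
    filter_upwards [hΩ.isOpen.mem_nhds hx] with y hy using h1 _ _ y hy (hr.of_le (by norm_num))
  rw [hev.fderiv_eq, fderiv_clm_apply hdiff (differentiableAt_const _)]
  simp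

/-- Real-linear functionals, such as the real and the imaginary part, commute with the parabolic
operator. -/
theorem map_parabolicOp (hΩ : IsBoundedC2Domain Ω) (hT : 0 < T)
    (hu : ContDiffOn ℝ 2 u (closedCylinder Ω T)) (hp : p ∈ cylinder Ω T) (l : ℂ →L[ℝ] ℝ) :
    l (parabolicOp ε 0 u p) = ε * cylDeriv Ω T (fun p => l (u p)) (0, 1) p -
      cylLaplacian Ω T (fun p => l (u p)) p := by
  have hr : ContDiffOn ℝ 2 (fun p => l (u p)) (closedCylinder Ω T) := l.contDiff.comp_contDiffOn hu
  have hpK := cylinder_subset_closedCylinder hp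
  have hnhds := closedCylinder_mem_nhds hΩ hp
  have hua : ContDiffAt ℝ 2 u p := hu.contDiffAt hnhds
  have hslice : ContDiffAt ℝ 2 (fun y => u (y, p.2)) p.1 :=
    ContDiffAt.comp p.1 (f := fun y => (y, p.2)) hua (contDiff_id.prodMk contDiff_const).contDiffAt
  have htime : DifferentiableAt ℝ (fun s => u (p.1, s)) p.2 :=
    DifferentiableAt.comp p.2 (f := fun s : ℝ => (p.1, s)) (hua.differentiableAt (by norm_num))
      (by fun_prop)
  rw [parabolicOp, cylLaplacian_eq_laplacian hΩ hT hr hp]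
  have h1 : l (Δ (fun y => u (y, p.2)) p.1) = Δ (fun y => l (u (y, p.2))) p.1 :=
    (hslice.laplacian_CLM_comp_left (l := l)).symm
  have h2 : cylDeriv Ω T (fun p => l (u p)) (0, 1) p = l (deriv (fun s => u (p.1, s)) p.2) := by
    have h3 := (hasDerivWithinAt_slice_time ((hr p hpK).differentiableWithinAt (by norm_num))
      hpK).hasDerivAt (Icc_mem_nhds hp.2.1 hp.2.2)
    exact h3.unique (l.hasFDerivAt.comp_hasDerivAt p.2 htime.hasDerivAt)
  rw [h2, ← h1, Pi.zero_apply, zero_mul, add_zero, map_sub, ← Complex.real_smul, map_smul,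
    smul_eq_mul]

theorem map_normalDeriv (hΩ : IsBoundedC2Domain Ω)
    (hu : ContDiffOn ℝ 2 u (closedCylinder Ω T)) (hp : p ∈ closedCylinder Ω T) (l : ℂ →L[ℝ] ℝ) :
    l (normalDeriv Ω u p.1 p.2) = lateralNormalDeriv Ω T (fun p => l (u p)) p := by
  have hr : ContDiffOn ℝ 2 (fun p => l (u p)) (closedCylinder Ω T) := l.contDiff.comp_contDiffOn hu
  have hs : DifferentiableWithinAt ℝ (fun y => u (y, p.2)) (closure Ω) p.1 :=
    DifferentiableWithinAt.comp p.1 (f := fun y => (y, p.2))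
      ((hu p hp).differentiableWithinAt (by norm_num)) (by fun_prop) fun _ hy => ⟨hy, hp.2⟩
  have h : HasFDerivWithinAt (fun y => l (u (y, p.2))) _ (closure Ω) p.1 :=
    l.hasFDerivAt.comp_hasFDerivWithinAt p.1 hs.hasFDerivWithinAt
  rw [lateralNormalDeriv, cylDeriv_eq_fderivWithin_slice hΩ
    ((hr p hp).differentiableWithinAt (by norm_num)) hp, normalDeriv,
    h.fderivWithin (hΩ.uniqueDiffOn_closure p.1 hp.1)]
  rfl

theorem lateralNormalDeriv_halfWeight_mul (hΩ : IsBoundedC2Domain Ω) (hT : 0 < T)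
    (hr : ContDiffOn ℝ 1 r (closedCylinder Ω T)) (hp : p ∈ closedCylinder Ω T) (hrp : r p = 0) :
    lateralNormalDeriv Ω T (fun p => halfWeight ε ω ρ p * r p) p =
      halfWeight ε ω ρ p * lateralNormalDeriv Ω T r p := by
  rw [lateralNormalDeriv, cylDeriv_halfWeight_mul hΩ hT hr hp, hrp, lateralNormalDeriv]
  ring

end Conjugation

/-! ### Weighted integrals of complex-valued functions -/

section WeightedIntegrals

variable {n : ℕ} {Ω : Set (EuclideanSpace ℝ (Fin n))} {T : ℝ}
  {ε s ρ : ℝ} {ω : EuclideanSpace ℝ (Fin n)} {u : EuclideanSpace ℝ (Fin n) × ℝ → ℂ}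
  {σ : Measure (EuclideanSpace ℝ (Fin n))} {C : ℝ≥0}

theorem norm_sq_eq_re_add_im (z : ℂ) :
    ‖z‖ ^ 2 = Complex.reCLM z ^ 2 + Complex.imCLM z ^ 2 := by
  rw [Complex.sq_norm, Complex.normSq_apply, Complex.reCLM_apply, Complex.imCLM_apply]
  ring

theorem measurableSet_boundaryPart (hΩ : IsBoundedC2Domain Ω) :
    MeasurableSet (boundaryPart Ω s ω) := by
  have hc : ContinuousOn (fun x => s * ⟪exteriorNormal Ω x, ω⟫_ℝ) (frontier Ω) :=
    continuousOn_const.mul (hΩ.continuousOn_exteriorNormal.inner continuousOn_const)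
  obtain ⟨U, hU, hUeq⟩ := continuousOn_iff'.1 hc (Ioi 0) isOpen_Ioi
  have : boundaryPart Ω s ω = U ∩ frontier Ω := by
    rw [← hUeq]
    ext x
    exact and_comm
  rw [this]
  exact hU.measurableSet.inter isClosed_frontier.measurableSet

/-- The function `exp (-ε (ρ ω · x + ρ² t)) l(u)` for a real-linear functional `l` on `ℂ`, to which
the estimate for the conjugated operator applies. Only the real and the imaginary part are used for
`l`. -/
def conjugated (ε : ℝ) (ω : EuclideanSpace ℝ (Fin n)) (ρ : ℝ)
    (u : EuclideanSpace ℝ (Fin n) × ℝ → ℂ) (l : ℂ →L[ℝ] ℝ)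
    (p : EuclideanSpace ℝ (Fin n) × ℝ) : ℝ :=
  halfWeight ε ω ρ p * l (u p)

theorem contDiffOn_conjugated (hu : ContDiffOn ℝ 2 u (closedCylinder Ω T)) (l : ℂ →L[ℝ] ℝ) :
    ContDiffOn ℝ 2 (conjugated ε ω ρ u l) (closedCylinder Ω T) :=
  contDiff_halfWeight.contDiffOn.mul (l.contDiff.comp_contDiffOn hu)

theorem weight_mul_norm_sq (p : EuclideanSpace ℝ (Fin n) × ℝ) :
    weight ε ω ρ p * ‖u p‖ ^ 2 = conjugated ε ω ρ u Complex.reCLM p ^ 2 +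
      conjugated ε ω ρ u Complex.imCLM p ^ 2 := by
  rw [norm_sq_eq_re_add_im, ← halfWeight_sq, conjugated, conjugated]
  ring

theorem weight_mul_parabolicOp_sq (hΩ : IsBoundedC2Domain Ω) (hT : 0 < T)
    (hu : ContDiffOn ℝ 2 u (closedCylinder Ω T)) {p : EuclideanSpace ℝ (Fin n) × ℝ}
    (hp : p ∈ cylinder Ω T) (hε : ε * ε = 1) (hω : ‖ω‖ = 1) :
    weight ε ω ρ p * ‖parabolicOp ε 0 u p‖ ^ 2 =
      conjugatedOp Ω T ε ω ρ (conjugated ε ω ρ u Complex.reCLM) p ^ 2 +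
      conjugatedOp Ω T ε ω ρ (conjugated ε ω ρ u Complex.imCLM) p ^ 2 := by
  have h : ∀ l : ℂ →L[ℝ] ℝ, conjugatedOp Ω T ε ω ρ (conjugated ε ω ρ u l) p =
      halfWeight ε ω ρ p * l (parabolicOp ε 0 u p) := fun l => by
    rw [map_parabolicOp hΩ hT hu hp]
    exact conjugatedOp_halfWeight_mul hΩ hT (l.contDiff.comp_contDiffOn hu)
      (cylinder_subset_closedCylinder hp) hε hω
  rw [h, h, norm_sq_eq_re_add_im, ← halfWeight_sq]
  ring

theorem weight_mul_normalDeriv_sq (hΩ : IsBoundedC2Domain Ω) (hT : 0 < T)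
    (hu : ContDiffOn ℝ 2 u (closedCylinder Ω T)) {p : EuclideanSpace ℝ (Fin n) × ℝ}
    (hp : p ∈ closedCylinder Ω T) (hup : u p = 0) :
    weight ε ω ρ p * ‖normalDeriv Ω u p.1 p.2‖ ^ 2 =
      lateralNormalDeriv Ω T (conjugated ε ω ρ u Complex.reCLM) p ^ 2 +
      lateralNormalDeriv Ω T (conjugated ε ω ρ u Complex.imCLM) p ^ 2 := by
  have h : ∀ l : ℂ →L[ℝ] ℝ, lateralNormalDeriv Ω T (conjugated ε ω ρ u l) p =
      halfWeight ε ω ρ p * l (normalDeriv Ω u p.1 p.2) := fun l => by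
    rw [map_normalDeriv hΩ hu hp]
    exact lateralNormalDeriv_halfWeight_mul hΩ hT
      ((l.contDiff.comp_contDiffOn hu).of_le (by norm_num)) hp (by rw [hup, map_zero])
  rw [h, h, norm_sq_eq_re_add_im, ← halfWeight_sq]
  ring

/-- The density of the lateral integral over `Σ_{s,ω}`, extended by zero to the lateral boundary:
it is `φ |∂_ν u|² (s ν · ω)⁺` where `u = 0`. -/
def lateralDensity (Ω : Set (EuclideanSpace ℝ (Fin n))) (T s ε : ℝ)
    (ω : EuclideanSpace ℝ (Fin n)) (ρ : ℝ) (u : EuclideanSpace ℝ (Fin n) × ℝ → ℂ)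
    (p : EuclideanSpace ℝ (Fin n) × ℝ) : ℝ :=
  lateralNormalDeriv Ω T (conjugated ε ω ρ u Complex.reCLM) p ^ 2 *
      max (s * ⟪exteriorNormal Ω p.1, ω⟫_ℝ) 0 +
    lateralNormalDeriv Ω T (conjugated ε ω ρ u Complex.imCLM) p ^ 2 *
      max (s * ⟪exteriorNormal Ω p.1, ω⟫_ℝ) 0

theorem lateralDensity_nonneg (p : EuclideanSpace ℝ (Fin n) × ℝ) :
    0 ≤ lateralDensity Ω T s ε ω ρ u p :=
  add_nonneg (mul_nonneg (sq_nonneg _) (le_max_right _ _))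
    (mul_nonneg (sq_nonneg _) (le_max_right _ _))

theorem IsBoundaryMeasure.integrable_conjugated_sq_mul (hσ : IsBoundaryMeasure Ω σ C)
    (hΩ : IsBoundedC2Domain Ω) (hT : 0 < T) (hu : ContDiffOn ℝ 2 u (closedCylinder Ω T))
    (l : ℂ →L[ℝ] ℝ) :
    Integrable (fun p => lateralNormalDeriv Ω T (conjugated ε ω ρ u l) p ^ 2 *
      max (s * ⟪exteriorNormal Ω p.1, ω⟫_ℝ) 0) (lateralMeasure T σ) :=
  hσ.integrable_lateralMeasure hΩ
    (((continuousOn_lateralNormalDeriv hΩ hT ((contDiffOn_conjugated hu l).of_le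
      (by norm_num))).pow 2).mul ((continuousOn_const.mul
        ((continuousOn_exteriorNormal_fst hΩ).inner continuousOn_const)).sup continuousOn_const))

theorem IsBoundaryMeasure.integrable_lateralDensity (hσ : IsBoundaryMeasure Ω σ C)
    (hΩ : IsBoundedC2Domain Ω) (hT : 0 < T) (hu : ContDiffOn ℝ 2 u (closedCylinder Ω T)) :
    Integrable (lateralDensity Ω T s ε ω ρ u) (lateralMeasure T σ) :=
  (hσ.integrable_conjugated_sq_mul hΩ hT hu _).add (hσ.integrable_conjugated_sq_mul hΩ hT hu _)

theorem lateralIntegral_eq (hΩ : IsBoundedC2Domain Ω) (hT : 0 < T)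
    (hu : ContDiffOn ℝ 2 u (closedCylinder Ω T))
    (hu0 : ∀ x ∈ frontier Ω, ∀ t ∈ Ioo 0 T, u (x, t) = 0) (hs : s = 1 ∨ s = -1) :
    lateralIntegral Ω T s ε ω ρ u = ∫⁻ t in Ioo 0 T, ∫⁻ x,
      ENNReal.ofReal (lateralDensity Ω T s ε ω ρ u (x, t)) ∂(surfaceMeasure Ω) := by
  rw [lateralIntegral]
  refine setLIntegral_congr_fun measurableSet_Ioo fun t ht => ?_
  have hm := measurableSet_boundaryPart (s := s) (ω := ω) hΩ
  have hsub : boundaryPart Ω s ω ⊆ frontier Ω := fun x hx => hx.1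
  have hres : (Measure.euclideanHausdorffMeasure (n - 1)).restrict (boundaryPart Ω s ω) =
      (surfaceMeasure Ω).restrict (boundaryPart Ω s ω) := by
    rw [surfaceMeasure, Measure.restrict_restrict hm, inter_eq_self_of_subset_left hsub]
  rw [hres, ← lintegral_indicator hm]
  refine lintegral_congr_ae ?_
  have hfr : ∀ᵐ x ∂(surfaceMeasure Ω), x ∈ frontier Ω :=
    ae_restrict_mem isClosed_frontier.measurableSet
  filter_upwards [hfr] with x hx
  have hK : (x, t) ∈ closedCylinder Ω T := ⟨frontier_subset_closure hx, Ioo_subset_Icc_self ht⟩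
  rw [lateralDensity, ← add_mul, ← weight_mul_normalDeriv_sq hΩ hT hu hK (hu0 x hx t ht)]
  by_cases hxb : x ∈ boundaryPart Ω s ω
  · rw [indicator_of_mem hxb]
    have hpos : 0 < s * ⟪exteriorNormal Ω x, ω⟫_ℝ := hxb.2
    have habs : |⟪ω, exteriorNormal Ω x⟫_ℝ| = s * ⟪exteriorNormal Ω x, ω⟫_ℝ := by
      rw [← abs_of_pos hpos, abs_mul, real_inner_comm]
      rcases hs with rfl | rfl <;> simp
    rw [max_eq_left hpos.le, habs]
  · rw [indicator_of_notMem hxb]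
    have hneg : s * ⟪exteriorNormal Ω x, ω⟫_ℝ ≤ 0 := not_lt.1 fun h => hxb ⟨hx, h⟩
    rw [max_eq_right hneg, mul_zero, ENNReal.ofReal_zero]

theorem IsBoundaryMeasure.ofReal_integral_lateralDensity (hσ : IsBoundaryMeasure Ω σ C)
    (hΩ : IsBoundedC2Domain Ω) (hT : 0 < T) (hu : ContDiffOn ℝ 2 u (closedCylinder Ω T)) :
    ENNReal.ofReal (∫ p, lateralDensity Ω T s ε ω ρ u p ∂(lateralMeasure T σ)) =
      ∫⁻ t in Ioo 0 T, ∫⁻ x, ENNReal.ofReal (lateralDensity Ω T s ε ω ρ u (x, t)) ∂σ := by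
  have := hσ.isFinite
  have hi := hσ.integrable_lateralDensity (s := s) (ε := ε) (ω := ω) (ρ := ρ) hΩ hT hu
  rw [ofReal_integral_eq_lintegral_ofReal hi (Eventually.of_forall lateralDensity_nonneg)]
  have hm : AEMeasurable (fun p => ENNReal.ofReal (lateralDensity Ω T s ε ω ρ u p))
    (lateralMeasure T σ) := hi.aemeasurable.ennreal_ofReal
  exact lintegral_prod_symm _ hm

theorem lintegral_lintegral_le_of_le_smul {X : Type*} [MeasurableSpace X] {μ ν : Measure X}
    {c : ℝ≥0} (h : μ ≤ c • ν) (f : X → ℝ → ℝ≥0∞) (S : Set ℝ) :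
    ∫⁻ t in S, ∫⁻ x, f x t ∂μ ≤ c * ∫⁻ t in S, ∫⁻ x, f x t ∂ν := by
  rw [← lintegral_const_mul' _ _ ENNReal.coe_ne_top]
  refine lintegral_mono fun t => ?_
  refine (lintegral_mono' h le_rfl).trans ?_
  rw [lintegral_smul_measure]
  rfl

/-- The estimate without the zeroth order term `q`, for complex-valued functions and with the
boundary measure `σ`. -/
theorem conjugated_estimate_complex (hσ : IsBoundaryMeasure Ω σ C)
    (hΩ : IsBoundedC2Domain Ω) (hT : 0 < T) {R : ℝ} (hR : 0 < R) (hΩR : ∀ x ∈ closure Ω, ‖x‖ ≤ R)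
    (hu : ContDiffOn ℝ 2 u (closedCylinder Ω T))
    (hu0 : ∀ x ∈ frontier Ω, ∀ t ∈ Ioo 0 T, u (x, t) = 0)
    (hε : ε = 1 ∨ ε = -1) (hub : ∀ x ∈ Ω, u (x, baseTime T ε) = 0) (hω : ‖ω‖ = 1) (hρ : 1 ≤ ρ) :
    (∫ x in Ω, weight ε ω ρ (x, baseTime T (-ε)) * ‖u (x, baseTime T (-ε))‖ ^ 2)
      + ρ * (∫ p, lateralDensity Ω T ε ε ω ρ u p ∂(lateralMeasure T σ))
      + ρ ^ 2 * (∫ p in cylinder Ω T, weight ε ω ρ p * ‖u p‖ ^ 2) ≤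
      2 * (9 * R + 9 * R ^ 2 + 1) *
        ((∫ p in cylinder Ω T, weight ε ω ρ p * ‖parabolicOp ε 0 u p‖ ^ 2)
        + ρ * (∫ p, lateralDensity Ω T (-ε) ε ω ρ u p ∂(lateralMeasure T σ))) := by
  have hv := fun l => contDiffOn_conjugated (ε := ε) (ω := ω) (ρ := ρ) hu l
  have hest := fun l => conjugated_estimate (ε := ε) (ω := ω) (ρ := ρ) hσ hΩ hT hR hΩR (hv l)
    (fun x hx t ht => by simp [conjugated, hu0 x hx t ht]) hε
    (fun x hx => by simp [conjugated, hub x hx]) hω hρ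
  have hε2 : ε * ε = 1 := by rcases hε with rfl | rfl <;> norm_num
  have hbt : baseTime T (-ε) ∈ Icc 0 T := by
    unfold baseTime
    split_ifs
    exacts [left_mem_Icc.2 hT.le, right_mem_Icc.2 hT.le]
  have hc : ∀ l, ContinuousOn (fun p => conjugated ε ω ρ u l p ^ 2) (closedCylinder Ω T) :=
    fun l => (hv l).continuousOn.pow 2
  have hY : ∀ l, IntegrableOn (fun p => conjugatedOp Ω T ε ω ρ (conjugated ε ω ρ u l) p ^ 2)
      (cylinder Ω T) := fun l =>
    integrableOn_cylinder hΩ ((continuousOn_conjugatedOp hΩ hT (hv l)).pow 2)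
  rw [setIntegral_congr_fun (isOpen_cylinder hΩ).measurableSet fun p hp =>
    weight_mul_parabolicOp_sq (ρ := ρ) hΩ hT hu hp hε2 hω]
  simp_rw [weight_mul_norm_sq, lateralDensity]
  rw [integral_add (integrableOn_slice hΩ (hc _) hbt) (integrableOn_slice hΩ (hc _) hbt),
    integral_add (integrableOn_cylinder hΩ (hc _)) (integrableOn_cylinder hΩ (hc _)),
    integral_add (hY _) (hY _),
    integral_add (hσ.integrable_conjugated_sq_mul hΩ hT hu _)
      (hσ.integrable_conjugated_sq_mul hΩ hT hu _),
    integral_add (hσ.integrable_conjugated_sq_mul hΩ hT hu _)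
      (hσ.integrable_conjugated_sq_mul hΩ hT hu _)]
  have h1 := hest Complex.reCLM
  have h2 := hest Complex.imCLM
  linarith

/-- `|Lu|² ≤ 2 |Lu + qu|² + 2 m² |u|²` under the integral. -/
theorem ofReal_integral_weight_mul_parabolicOp_sq_le (hΩ : IsBoundedC2Domain Ω) (hT : 0 < T)
    (hu : ContDiffOn ℝ 2 u (closedCylinder Ω T)) (hε : ε * ε = 1) (hω : ‖ω‖ = 1) {m : ℝ}
    (hm : 0 < m) {q : EuclideanSpace ℝ (Fin n) × ℝ → ℂ}
    (hq : eLpNorm q ⊤ (volume.restrict (cylinder Ω T)) ≤ ENNReal.ofReal m) :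
    ENNReal.ofReal (∫ p in cylinder Ω T, weight ε ω ρ p * ‖parabolicOp ε 0 u p‖ ^ 2) ≤
      2 * (∫⁻ p in cylinder Ω T, ENNReal.ofReal (weight ε ω ρ p * ‖parabolicOp ε q u p‖ ^ 2)) +
      ENNReal.ofReal (2 * m ^ 2 * ∫ p in cylinder Ω T, weight ε ω ρ p * ‖u p‖ ^ 2) := by
  have hw0 : ∀ p, 0 ≤ weight ε ω ρ p := fun p => (Real.exp_pos _).le
  have hiu : IntegrableOn (fun p => weight ε ω ρ p * ‖u p‖ ^ 2) (cylinder Ω T) := by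
    simp_rw [weight_mul_norm_sq]
    exact integrableOn_cylinder hΩ (((contDiffOn_conjugated hu _).continuousOn.pow 2).add
      ((contDiffOn_conjugated hu _).continuousOn.pow 2))
  have hiL : IntegrableOn (fun p => weight ε ω ρ p * ‖parabolicOp ε 0 u p‖ ^ 2)
      (cylinder Ω T) := by
    rw [integrableOn_congr_fun (fun p hp => weight_mul_parabolicOp_sq (ρ := ρ) hΩ hT hu hp hε hω)
      (isOpen_cylinder hΩ).measurableSet]
    exact integrableOn_cylinder hΩ
      (((continuousOn_conjugatedOp hΩ hT (contDiffOn_conjugated hu _)).pow 2).add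
        ((continuousOn_conjugatedOp hΩ hT (contDiffOn_conjugated hu _)).pow 2))
  rw [← integral_const_mul,
    ofReal_integral_eq_lintegral_ofReal hiL (Eventually.of_forall fun p =>
      mul_nonneg (hw0 p) (sq_nonneg _)),
    ofReal_integral_eq_lintegral_ofReal (hiu.const_mul _) (Eventually.of_forall fun p =>
      mul_nonneg (by positivity) (mul_nonneg (hw0 p) (sq_nonneg _))),
    ← lintegral_const_mul' _ _ (by norm_num),
    ← lintegral_add_right' _ (hiu.const_mul (2 * m ^ 2)).aemeasurable.ennreal_ofReal]
  refine lintegral_mono_ae ?_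
  rw [eLpNorm_exponent_top] at hq
  filter_upwards [ae_le_eLpNormEssSup (f := q) (μ := volume.restrict (cylinder Ω T))] with p hp
  have hqp : ‖q p‖ ≤ m := by
    have := hp.trans hq
    rwa [← ofReal_norm, ENNReal.ofReal_le_ofReal_iff hm.le] at this
  have htwo : (2 : ℝ≥0∞) = ENNReal.ofReal 2 := by norm_num
  rw [htwo, ← ENNReal.ofReal_mul (by norm_num), ← ENNReal.ofReal_add
    (mul_nonneg (by norm_num) (mul_nonneg (hw0 p) (sq_nonneg _)))
    (mul_nonneg (by positivity) (mul_nonneg (hw0 p) (sq_nonneg _)))]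
  refine ENNReal.ofReal_le_ofReal ?_
  have hL : parabolicOp ε 0 u p = parabolicOp ε q u p - q p * u p := by
    simp [parabolicOp]
  have h1 : ‖parabolicOp ε 0 u p‖ ≤ ‖parabolicOp ε q u p‖ + m * ‖u p‖ := by
    rw [hL]
    refine (norm_sub_le _ _).trans ?_
    rw [norm_mul]
    gcongr
  have h2 : ‖parabolicOp ε 0 u p‖ ^ 2 ≤ 2 * ‖parabolicOp ε q u p‖ ^ 2 + 2 * m ^ 2 * ‖u p‖ ^ 2 := by
    have h3 := pow_le_pow_left₀ (norm_nonneg _) h1 2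
    nlinarith [sq_nonneg (‖parabolicOp ε q u p‖ - m * ‖u p‖)]
  nlinarith [mul_le_mul_of_nonneg_left h2 (hw0 p)]

end WeightedIntegrals

end ParabolicCarleman

end

theorem theoremt2 (n : ℕ) (hn : 2 ≤ n) (Ω : Set (EuclideanSpace ℝ (Fin n)))
    (hΩ : ParabolicCarleman.IsBoundedC2Domain Ω) (T : ℝ) (hT : 0 < T) :
    ∃ C : ℝ, 0 < C ∧ ∀ m : ℝ, 0 < m → ∃ ρ₀ : ℝ, 0 < ρ₀ ∧
      ∀ ε : ℝ, (ε = 1 ∨ ε = -1) →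
      ∀ ω : EuclideanSpace ℝ (Fin n), ‖ω‖ = 1 →
      ∀ q : EuclideanSpace ℝ (Fin n) × ℝ → ℂ,
        MemLp q ⊤ (volume.restrict (ParabolicCarleman.cylinder Ω T)) →
        eLpNorm q ⊤ (volume.restrict (ParabolicCarleman.cylinder Ω T)) ≤ ENNReal.ofReal m →
      ∀ ρ : ℝ, ρ₀ ≤ ρ →
      ∀ u : EuclideanSpace ℝ (Fin n) × ℝ → ℂ,
        ContDiffOn ℝ 2 u (closure Ω ×ˢ Icc 0 T) →
        (∀ x ∈ frontier Ω, ∀ t ∈ Ioo 0 T, u (x, t) = 0) →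
        (∀ x ∈ Ω, u (x, ParabolicCarleman.baseTime T ε) = 0) →
        (∫⁻ x in Ω, ENNReal.ofReal
              (ParabolicCarleman.weight ε ω ρ (x, ParabolicCarleman.baseTime T (-ε)) *
                ‖u (x, ParabolicCarleman.baseTime T (-ε))‖ ^ 2))
            + ENNReal.ofReal ρ * ParabolicCarleman.lateralIntegral Ω T ε ε ω ρ u
            + ENNReal.ofReal (ρ ^ 2) * (∫⁻ p in ParabolicCarleman.cylinder Ω T, ENNReal.ofReal
                (ParabolicCarleman.weight ε ω ρ p * ‖u p‖ ^ 2))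
          ≤ ENNReal.ofReal C *
            ((∫⁻ p in ParabolicCarleman.cylinder Ω T, ENNReal.ofReal
                (ParabolicCarleman.weight ε ω ρ p *
                  ‖ParabolicCarleman.parabolicOp ε q u p‖ ^ 2))
              + ENNReal.ofReal ρ * ParabolicCarleman.lateralIntegral Ω T (-ε) ε ω ρ u) := by
  obtain ⟨σ, c, hσ⟩ := hΩ.exists_isBoundaryMeasure
  obtain ⟨R, hR, hΩR⟩ := hΩ.isBounded.closure.exists_pos_norm_le
  -- `C₁` is the constant without the zeroth order term, and `c` compares `σ` with the surface
  -- measure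
  set C₁ : ℝ := 2 * (9 * R + 9 * R ^ 2 + 1) with hC₁
  have hC₁0 : 0 < C₁ := by positivity
  refine ⟨(1 + c) ^ 2 * (4 * C₁), by positivity,
    fun m hm => ⟨1 + 4 * C₁ * m ^ 2, by positivity, ?_⟩⟩
  intro ε hε ω hω q _ hq ρ hρ u hu hu0 hub
  have hpos : 0 ≤ 4 * C₁ * m ^ 2 := by positivity
  have hρ1 : 1 ≤ ρ := by linarith
  have hρ0 : 0 < ρ := by linarith
  -- this is what makes the zeroth order term absorbable
  have hρm : 4 * C₁ * m ^ 2 ≤ ρ ^ 2 := by nlinarith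
  have hε2 : ε * ε = 1 := by rcases hε with rfl | rfl <;> norm_num
  have hε' : -ε = 1 ∨ -ε = -1 := by rcases hε with rfl | rfl <;> simp
  have hw0 : ∀ p, 0 ≤ ParabolicCarleman.weight ε ω ρ p := fun p => (Real.exp_pos _).le
  have hbt : ParabolicCarleman.baseTime T (-ε) ∈ Icc 0 T := by
    unfold ParabolicCarleman.baseTime
    split_ifs
    exacts [left_mem_Icc.2 hT.le, right_mem_Icc.2 hT.le]
  have hest := ParabolicCarleman.conjugated_estimate_complex hσ hΩ hT hR hΩR hu hu0 hε hub hω hρ1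
  have hLq := ParabolicCarleman.ofReal_integral_weight_mul_parabolicOp_sq_le (ρ := ρ) hΩ hT hu hε2
    hω hm hq
  have hcont : ContinuousOn (fun p => ParabolicCarleman.weight ε ω ρ p * ‖u p‖ ^ 2)
      (ParabolicCarleman.closedCylinder Ω T) := by
    simp_rw [ParabolicCarleman.weight_mul_norm_sq]
    exact ((ParabolicCarleman.contDiffOn_conjugated hu _).continuousOn.pow 2).add
      ((ParabolicCarleman.contDiffOn_conjugated hu _).continuousOn.pow 2)
  rw [← ofReal_integral_eq_lintegral_ofReal (ParabolicCarleman.integrableOn_slice hΩ hcont hbt)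
      (Filter.Eventually.of_forall fun x => mul_nonneg (hw0 _) (sq_nonneg _)),
    ← ofReal_integral_eq_lintegral_ofReal (ParabolicCarleman.integrableOn_cylinder hΩ hcont)
      (Filter.Eventually.of_forall fun x => mul_nonneg (hw0 _) (sq_nonneg _))]
  -- the surface measure against the boundary measure `σ`, in both directions
  have hle : ParabolicCarleman.lateralIntegral Ω T ε ε ω ρ u ≤ c * ENNReal.ofReal
      (∫ p, ParabolicCarleman.lateralDensity Ω T ε ε ω ρ u p
        ∂(ParabolicCarleman.lateralMeasure T σ)) := by
    rw [ParabolicCarleman.lateralIntegral_eq hΩ hT hu hu0 hε,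
      hσ.ofReal_integral_lateralDensity hΩ hT hu]
    exact ParabolicCarleman.lintegral_lintegral_le_of_le_smul hσ.surface_le _ _
  have hge : ENNReal.ofReal (∫ p, ParabolicCarleman.lateralDensity Ω T (-ε) ε ω ρ u p
        ∂(ParabolicCarleman.lateralMeasure T σ)) ≤
      c * ParabolicCarleman.lateralIntegral Ω T (-ε) ε ω ρ u := by
    rw [ParabolicCarleman.lateralIntegral_eq hΩ hT hu hu0 hε',
      hσ.ofReal_integral_lateralDensity hΩ hT hu]
    exact ParabolicCarleman.lintegral_lintegral_le_of_le_smul hσ.le_surface _ _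
  have hA0 : 0 ≤ ∫ x in Ω, ParabolicCarleman.weight ε ω ρ (x, ParabolicCarleman.baseTime T (-ε)) *
      ‖u (x, ParabolicCarleman.baseTime T (-ε))‖ ^ 2 :=
    integral_nonneg fun x => mul_nonneg (hw0 _) (sq_nonneg _)
  have hB0 : 0 ≤ ∫ p in ParabolicCarleman.cylinder Ω T,
      ParabolicCarleman.weight ε ω ρ p * ‖u p‖ ^ 2 :=
    integral_nonneg fun x => mul_nonneg (hw0 _) (sq_nonneg _)
  have hS0 : ∀ s, 0 ≤ ∫ p, ParabolicCarleman.lateralDensity Ω T s ε ω ρ u p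
      ∂(ParabolicCarleman.lateralMeasure T σ) := fun s =>
    integral_nonneg ParabolicCarleman.lateralDensity_nonneg
  have hSε := hS0 ε
  have hSε' := hS0 (-ε)
  clear hcont
  generalize (∫ x in Ω, ParabolicCarleman.weight ε ω ρ (x, ParabolicCarleman.baseTime T (-ε)) *
      ‖u (x, ParabolicCarleman.baseTime T (-ε))‖ ^ 2) = A at *
  generalize (∫ p in ParabolicCarleman.cylinder Ω T,
      ParabolicCarleman.weight ε ω ρ p * ‖u p‖ ^ 2) = B at *
  generalize (∫ p in ParabolicCarleman.cylinder Ω T,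
      ParabolicCarleman.weight ε ω ρ p * ‖ParabolicCarleman.parabolicOp ε 0 u p‖ ^ 2) = Y at *
  generalize (∫ p, ParabolicCarleman.lateralDensity Ω T ε ε ω ρ u p
      ∂(ParabolicCarleman.lateralMeasure T σ)) = S at *
  generalize (∫ p, ParabolicCarleman.lateralDensity Ω T (-ε) ε ω ρ u p
      ∂(ParabolicCarleman.lateralMeasure T σ)) = S' at *
  generalize (∫⁻ p in ParabolicCarleman.cylinder Ω T, ENNReal.ofReal
      (ParabolicCarleman.weight ε ω ρ p * ‖ParabolicCarleman.parabolicOp ε q u p‖ ^ 2)) = I at *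
  generalize ParabolicCarleman.lateralIntegral Ω T ε ε ω ρ u = Λ at *
  generalize ParabolicCarleman.lateralIntegral Ω T (-ε) ε ω ρ u = Λ' at *
  have hCpos : (0 : ℝ) < (1 + c) ^ 2 * (4 * C₁) := by positivity
  -- if the right-hand side is infinite there is nothing to prove
  by_cases hI : I = ⊤
  · rw [hI, top_add, ENNReal.mul_top (ENNReal.ofReal_pos.2 hCpos).ne']
    exact le_top
  obtain ⟨i, hi0, rfl⟩ : ∃ i : ℝ, 0 ≤ i ∧ I = ENNReal.ofReal i :=
    ⟨I.toReal, ENNReal.toReal_nonneg, (ENNReal.ofReal_toReal hI).symm⟩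
  have hY : Y ≤ 2 * i + 2 * m ^ 2 * B := by
    have htwo : (2 : ENNReal) = ENNReal.ofReal 2 := by norm_num
    rw [htwo, ← ENNReal.ofReal_mul (by norm_num), ← ENNReal.ofReal_add (by positivity)
      (by positivity), ENNReal.ofReal_le_ofReal_iff (by positivity)] at hLq
    exact hLq
  -- here `ρ² ≥ 4 C₁ m²`: the term from `q` takes at most half of `ρ² B`
  have hreal : A + ρ * S + ρ ^ 2 * B ≤ 4 * C₁ * (i + ρ * S') := by
    have h1 : C₁ * Y ≤ C₁ * (2 * i + 2 * m ^ 2 * B) := mul_le_mul_of_nonneg_left hY hC₁0.le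
    have h2 : 4 * C₁ * m ^ 2 * B ≤ ρ ^ 2 * B := mul_le_mul_of_nonneg_right hρm hB0
    have h3 : 0 ≤ C₁ * (ρ * S') := by positivity
    have h4 : 0 ≤ ρ * S := by positivity
    linarith
  have hc1 : ENNReal.ofReal (1 + (c : ℝ)) = 1 + (c : ENNReal) := by
    rw [ENNReal.ofReal_add zero_le_one c.coe_nonneg, ENNReal.ofReal_one, ENNReal.ofReal_coe_nnreal]
  have h1c : (1 : ENNReal) ≤ 1 + c := le_self_add
  have hc1' : (c : ENNReal) ≤ 1 + c := le_add_self
  calc ENNReal.ofReal A + ENNReal.ofReal ρ * Λ + ENNReal.ofReal (ρ ^ 2) * ENNReal.ofReal B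
      ≤ (1 + c) * ENNReal.ofReal A + ENNReal.ofReal ρ * ((1 + c) * ENNReal.ofReal S) +
          (1 + c) * (ENNReal.ofReal (ρ ^ 2) * ENNReal.ofReal B) := by
        refine add_le_add (add_le_add (le_mul_of_one_le_left zero_le h1c) ?_)
          (le_mul_of_one_le_left zero_le h1c)
        gcongr
        exact hle.trans (mul_le_mul_left hc1' _)
    _ = (1 + c) * ENNReal.ofReal (A + ρ * S + ρ ^ 2 * B) := by
        rw [ENNReal.ofReal_add (by positivity) (by positivity),
          ENNReal.ofReal_add hA0 (by positivity), ENNReal.ofReal_mul hρ0.le,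
          ENNReal.ofReal_mul (sq_nonneg ρ)]
        ring
    _ ≤ (1 + c) * ENNReal.ofReal (4 * C₁ * (i + ρ * S')) := by gcongr
    _ = (1 + c) * ENNReal.ofReal (4 * C₁) * (ENNReal.ofReal i + ENNReal.ofReal ρ *
          ENNReal.ofReal S') := by
        rw [ENNReal.ofReal_mul (by positivity), ENNReal.ofReal_add hi0 (by positivity),
          ENNReal.ofReal_mul hρ0.le, mul_assoc]
    _ ≤ (1 + c) * ENNReal.ofReal (4 * C₁) * ((1 + c) * ENNReal.ofReal i + ENNReal.ofReal ρ *
          ((1 + c) * Λ')) := by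
        gcongr
        · exact le_mul_of_one_le_left zero_le h1c
        · exact hge.trans (mul_le_mul_left hc1' _)
    _ = ENNReal.ofReal ((1 + c) ^ 2 * (4 * C₁)) * (ENNReal.ofReal i + ENNReal.ofReal ρ * Λ') := by
        rw [ENNReal.ofReal_mul (p := (1 + (c : ℝ)) ^ 2) (by positivity),
          ENNReal.ofReal_pow (by positivity), hc1]
        ring
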